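/- A Minkowski plane is a two-dimensional real normed space $V$. Let $B=\{x:\|x\|\le 1\}$ be its unit disc and $S=\{x:\|x\|=1\}$ its unit circle. Fix an area on $V$, i.e. a translation-invariant (Haar) measure; the ratios below do not depend on this choice. Write $\mathrm{Area}(S)$ for the area of $B$, the region bounded by $S$. Let $\ell(S)$ be the length, measured in the norm, of $S$ parametrized as a simple closed curve $\gamma:[a,b]\to V$, that is, the supremum of $\sum_{i}\|\gamma(t_{i})-\gamma(t_{i-1})\|$ over all partitions $a=t_0<t_1<\dots<t_n=b$. A parallelogram (together with its interior, and nondegenerate) is circumscribed about a set if it contains the set and each of its four sides touches the set. The convex disc $B$ (equivalently its boundary $S$) is called equiframed if every point of the boundary of $B$ lies on the boundary of some parallelogram of minimum area among those circumscribed about $B$. $S$ is an affine regular hexagon if it is the image, under a bijective affine map, of the boundary of a regular hexagon. Let $P$ be a parallelogram of minimum area among all parallelograms circumscribed about $S$. Then $$\frac{\mathrm{Area}(S)}{\mathrm{Area}(P)}\ \ge\ \frac{\ell(S)}{8},$$ with equality if and only if $S$ is equiframed. Moreover, $$\frac{\mathrm{Area}(S)}{\mathrm{Area}(P)}\ \ge\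 \frac34,$$ with equality if and only if $S$ is an affine regular hexagon. -/

import Mathlib

namespace MinkowskiPlane

open scoped Pointwise

/-- The (possibly degenerate) closed parallelogram with vertices `p`, `p + u`, `p + u + v`,
`p + v`. -/
def parallelogram {V : Type*} [AddCommGroup V] [Module ℝ V] (p u v : V) : Set V :=
  p +ᵥ parallelepiped ![u, v]

/-- `P` is a (nondegenerate) parallelogram circumscribed about the set `K`: it contains `K`, and
each of its four sides touches `K`. -/
def IsCircumscribedParallelogram {V : Type*} [AddCommGroup V] [Module ℝ V] (K P : Set V) : Prop :=
  ∃ p u v : V, LinearIndependent ℝ ![u, v] ∧ P = parallelogram p u v ∧ K ⊆ P ∧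
    (segment ℝ p (p + u) ∩ K).Nonempty ∧
    (segment ℝ (p + u) (p + u + v) ∩ K).Nonempty ∧
    (segment ℝ (p + u + v) (p + v) ∩ K).Nonempty ∧
    (segment ℝ (p + v) p ∩ K).Nonempty

/-- `P` has minimum area (measured by `μ`) among the parallelograms circumscribed about `K`. -/
def IsMinCircumscribedParallelogram {V : Type*} [AddCommGroup V] [Module ℝ V] [MeasurableSpace V]
    (μ : MeasureTheory.Measure V) (K P : Set V) : Prop :=
  IsCircumscribedParallelogram K P ∧ ∀ Q : Set V, IsCircumscribedParallelogram K Q → μ P ≤ μ Q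

/-- A convex disc `K` is equiframed if each of its boundary points lies on the boundary of a
circumscribed parallelogram of minimum area. -/
def IsEquiframed {V : Type*} [AddCommGroup V] [Module ℝ V] [TopologicalSpace V]
    [MeasurableSpace V] (μ : MeasureTheory.Measure V) (K : Set V) : Prop :=
  ∀ x ∈ frontier K, ∃ P : Set V, IsMinCircumscribedParallelogram μ K P ∧ x ∈ frontier P

/-- `γ`, restricted to `[a, b]`, parametrizes the set `S` as a simple closed curve. -/
def IsSimpleClosedParametrization {V : Type*} [TopologicalSpace V] (γ : ℝ → V) (a b : ℝ)
    (S : Set V) : Prop :=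
  a < b ∧ ContinuousOn γ (Set.Icc a b) ∧ γ a = γ b ∧ Set.InjOn γ (Set.Ico a b) ∧
    γ '' Set.Icc a b = S

/-- The length of the curve `γ : [a, b] → V`: the supremum of the lengths of the polygonal paths
`γ t₀, γ t₁, …, γ tₙ` over all `a ≤ t₀ ≤ t₁ ≤ … ≤ tₙ ≤ b`. -/
noncomputable def curveLength {V : Type*} [PseudoEMetricSpace V] (γ : ℝ → V) (a b : ℝ) : ENNReal :=
  eVariationOn γ (Set.Icc a b)

/-- The closed curve `S` is an affine regular hexagon: the image under a bijective affine map of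
the boundary of the regular hexagon whose vertices are the sixth roots of unity. -/
def IsAffineRegularHexagon {V : Type*} [AddCommGroup V] [Module ℝ V] (S : Set V) : Prop :=
  ∃ f : ℂ ≃ᵃ[ℝ] V, S = f '' frontier (convexHull ℝ {z : ℂ | z ^ 6 = 1})

end MinkowskiPlane

namespace MinkowskiPlane

open MeasureTheory Set Metric Filter Topology

set_option linter.unusedSectionVars false

/-! Since the unit disc `B` is symmetric, every circumscribed parallelogram is centred, hence of the
form `{|φ| ≤ 1, |ψ| ≤ 1}` with `‖φ‖ = ‖ψ‖ = 1`, and its area is inversely proportional to the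
determinant of `φ, ψ`. In the basis dual to the pair that cuts out `P`, the area of `P` is 4 and
minimality becomes `|dualWedge e φ ψ| ≤ ‖φ‖ * ‖ψ‖` (`IsExtremal`). What remains is to compare the
length with twice the area of `B`, and the area of `B` with 3.

Both inequalities come from one estimate on a chord `[x, y]` of the circle
(`norm_sub_le_mul_measure_sector`). Let `z = s x + t y` be the point of the circle furthest from the
chord, with `φ` the unit functional constant on the chord and `φ z = 1`, and let `ψ` be a norming
functional of `y - x`. The sector over the chord contains the triangles `0xz` and `0zy`, of total
area `(s + t)|x ∧ y| / 2`, while `‖y - x‖ = |φ ∧ ψ| (s + t)|x ∧ y|`. As `|φ ∧ ψ| ≤ 1`, the chord is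
at most twice the area of its sector. Summing over fine partitions bounds the length by twice the
area. Applied to the six unit sides of an inscribed affine regular hexagon, the estimate gives area
at least 3.

Equality in the length bound: near a point with no frame, compactness improves the constant 1 to `1
- η` (`IsExtremal.exists_gap`), so the inequality is strict. If every point is framed, short chords
satisfy `|x ∧ y| ≤ (1 + ε)‖y - x‖` (`exists_abs_wedge_le`), and adding up thin sectors gives the
reverse inequality as `ε → 0`.

Equality in the area bound: each sector over a unit chord has area exactly 1/2. Either `|x ∧ y| =
1`, and the inscribed hexagon already fills the disc, or the sector is a quadrilateral with a corner
`z`. Tilting the supporting functional at the corner, and repeating the argument for a hexagon with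
a side equal to `z`, excludes the second case for at least one of the two hexagons
(`IsExtremal.exists_wedge_eq_one`). Conversely, `abs_det_le_one` bounds the area of a hexagonal disc
by 3. -/

lemma mem_parallelepiped_pair {V : Type*} [AddCommGroup V] [Module ℝ V] {x y v : V} :
    v ∈ parallelepiped ![x, y] ↔
      ∃ s t : ℝ, 0 ≤ s ∧ s ≤ 1 ∧ 0 ≤ t ∧ t ≤ 1 ∧ v = s • x + t • y := by
  rw [mem_parallelepiped_iff]
  constructor
  · rintro ⟨t, ht, rfl⟩
    exact ⟨t 0, t 1, ht.1 0, ht.2 0, ht.1 1, ht.2 1, by simp [Fin.sum_univ_two]⟩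
  · rintro ⟨s, t, h1, h2, h3, h4, rfl⟩
    refine ⟨![s, t], ⟨?_, ?_⟩, by simp [Fin.sum_univ_two]⟩ <;> intro i <;> fin_cases i <;> simp [*]

/-! ### Determinants of vectors and of functionals in a plane -/

section Wedge

variable {V : Type*} [NormedAddCommGroup V] [NormedSpace ℝ V]

/-- The determinant of two vectors of a plane in the coordinates given by a basis. -/
noncomputable def wedge (e : Module.Basis (Fin 2) ℝ V) (x y : V) : ℝ :=
  e.repr x 0 * e.repr y 1 - e.repr x 1 * e.repr y 0

/-- The determinant of two functionals on a plane in the coordinates dual to a basis. -/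
noncomputable def dualWedge (e : Module.Basis (Fin 2) ℝ V) (φ ψ : V →L[ℝ] ℝ) : ℝ :=
  φ (e 0) * ψ (e 1) - φ (e 1) * ψ (e 0)

variable (e : Module.Basis (Fin 2) ℝ V)

lemma wedge_add_left (x y z : V) : wedge e (x + y) z = wedge e x z + wedge e y z := by
  simp only [wedge, map_add, Finsupp.add_apply]; ring

lemma wedge_add_right (x y z : V) : wedge e x (y + z) = wedge e x y + wedge e x z := by
  simp only [wedge, map_add, Finsupp.add_apply]; ring

lemma wedge_sub_left (x y z : V) : wedge e (x - y) z = wedge e x z - wedge e y z := by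
  simp only [wedge, map_sub, Finsupp.sub_apply]; ring

lemma wedge_sub_right (x y z : V) : wedge e x (y - z) = wedge e x y - wedge e x z := by
  simp only [wedge, map_sub, Finsupp.sub_apply]; ring

lemma wedge_smul_left (r : ℝ) (x y : V) : wedge e (r • x) y = r * wedge e x y := by
  simp only [wedge, map_smul, Finsupp.smul_apply, smul_eq_mul]; ring

lemma wedge_smul_right (r : ℝ) (x y : V) : wedge e x (r • y) = r * wedge e x y := by
  simp only [wedge, map_smul, Finsupp.smul_apply, smul_eq_mul]; ring

lemma wedge_neg_left (x y : V) : wedge e (-x) y = -wedge e x y := by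
  simp only [wedge, map_neg, Finsupp.neg_apply]; ring

lemma wedge_neg_right (x y : V) : wedge e x (-y) = -wedge e x y := by
  simp only [wedge, map_neg, Finsupp.neg_apply]; ring

lemma wedge_self (x : V) : wedge e x x = 0 := by
  simp only [wedge]; ring

lemma wedge_swap (x y : V) : wedge e y x = -wedge e x y := by
  simp only [wedge]; ring

lemma wedge_zero_left (y : V) : wedge e 0 y = 0 := by simp [wedge]

lemma wedge_zero_right (y : V) : wedge e y 0 = 0 := by simp [wedge]

lemma eq_repr_smul_add (x : V) : x = e.repr x 0 • e 0 + e.repr x 1 • e 1 := by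
  rw [← Fin.sum_univ_two (fun i => e.repr x i • e i), e.sum_repr]

lemma apply_eq_repr (φ : V →L[ℝ] ℝ) (x : V) :
    φ x = e.repr x 0 * φ (e 0) + e.repr x 1 * φ (e 1) := by
  conv_lhs => rw [eq_repr_smul_add e x]
  simp

/-- Multiplicativity of the determinant for the 2×2 matrix of pairings. This is the bridge between
areas, which are determinants of vectors, and minimality, which concerns determinants of
functionals. -/
lemma dualWedge_mul_wedge (φ ψ : V →L[ℝ] ℝ) (x y : V) :
    dualWedge e φ ψ * wedge e x y = φ x * ψ y - φ y * ψ x := by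
  rw [apply_eq_repr e φ x, apply_eq_repr e φ y, apply_eq_repr e ψ x, apply_eq_repr e ψ y,
    dualWedge, wedge]
  ring

lemma dualWedge_swap (φ ψ : V →L[ℝ] ℝ) : dualWedge e ψ φ = -dualWedge e φ ψ := by
  simp only [dualWedge]; ring

lemma dualWedge_neg_left (φ ψ : V →L[ℝ] ℝ) : dualWedge e (-φ) ψ = -dualWedge e φ ψ := by
  simp only [dualWedge, neg_apply]; ring

lemma dualWedge_smul_left (r : ℝ) (φ ψ : V →L[ℝ] ℝ) :
    dualWedge e (r • φ) ψ = r * dualWedge e φ ψ := by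
  simp only [dualWedge, smul_apply, smul_eq_mul]; ring

lemma dualWedge_smul_right (r : ℝ) (φ ψ : V →L[ℝ] ℝ) :
    dualWedge e φ (r • ψ) = r * dualWedge e φ ψ := by
  simp only [dualWedge, smul_apply, smul_eq_mul]; ring

lemma dualWedge_add_left (φ φ' ψ : V →L[ℝ] ℝ) :
    dualWedge e (φ + φ') ψ = dualWedge e φ ψ + dualWedge e φ' ψ := by
  simp only [dualWedge, add_apply]; ring

/-- Cramer's rule. -/
lemma eq_smul_add_of_wedge_ne_zero {x y : V} (h : wedge e x y ≠ 0) (v : V) :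
    v = (wedge e v y / wedge e x y) • x + (wedge e x v / wedge e x y) • y := by
  apply e.repr.injective
  ext i
  simp only [map_add, map_smul, Finsupp.add_apply, Finsupp.smul_apply, smul_eq_mul]
  field_simp
  fin_cases i <;> simp only [wedge, Fin.zero_eta, Fin.mk_one] <;> ring

lemma wedge_smul_add_smul_right (x y : V) (s t : ℝ) :
    wedge e (s • x + t • y) y = s * wedge e x y := by
  rw [wedge_add_left, wedge_smul_left, wedge_smul_left, wedge_self]; ring

lemma wedge_left_smul_add_smul (x y : V) (s t : ℝ) :
    wedge e x (s • x + t • y) = t * wedge e x y := by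
  rw [wedge_add_right, wedge_smul_right, wedge_smul_right, wedge_self]; ring

lemma exists_smul_of_wedge_eq_zero {x y : V} (hx : x ≠ 0) (h : wedge e x y = 0) :
    ∃ r : ℝ, y = r • x := by
  have hx' : e.repr x 0 ≠ 0 ∨ e.repr x 1 ≠ 0 := by
    by_contra! hc
    apply hx
    rw [eq_repr_smul_add e x, hc.1, hc.2]; simp
  unfold wedge at h
  rcases hx' with h0 | h0
  · refine ⟨e.repr y 0 / e.repr x 0, e.repr.injective ?_⟩
    ext i
    simp only [map_smul, Finsupp.smul_apply, smul_eq_mul]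
    field_simp
    fin_cases i <;> simp only [Fin.zero_eta, Fin.mk_one]
    all_goals linarith
  · refine ⟨e.repr y 1 / e.repr x 1, e.repr.injective ?_⟩
    ext i
    simp only [map_smul, Finsupp.smul_apply, smul_eq_mul]
    field_simp
    fin_cases i <;> simp only [Fin.zero_eta, Fin.mk_one]
    all_goals linarith

lemma eq_or_eq_neg_of_wedge_eq_zero {x y : V} (hx : ‖x‖ = 1) (hy : ‖y‖ = 1)
    (h : wedge e x y = 0) : y = x ∨ y = -x := by
  have hx0 : x ≠ 0 := by rw [← norm_ne_zero_iff, hx]; norm_num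
  obtain ⟨r, rfl⟩ := exists_smul_of_wedge_eq_zero e hx0 h
  rw [norm_smul, hx, mul_one, Real.norm_eq_abs] at hy
  rcases (abs_eq zero_le_one).1 hy with h | h <;> simp [h]

variable [FiniteDimensional ℝ V]

lemma continuous_repr (i : Fin 2) : Continuous fun x : V => e.repr x i :=
  (e.coord i).continuous_of_finiteDimensional

lemma Continuous.wedge {X : Type*} [TopologicalSpace X] {f g : X → V} (hf : Continuous f)
    (hg : Continuous g) : Continuous fun x => wedge e (f x) (g x) := by
  have h0 := continuous_repr e 0
  have h1 := continuous_repr e 1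
  exact ((h0.comp hf).mul (h1.comp hg)).sub ((h1.comp hf).mul (h0.comp hg))

lemma Continuous.dualWedge {X : Type*} [TopologicalSpace X] {f g : X → V →L[ℝ] ℝ}
    (hf : Continuous f) (hg : Continuous g) : Continuous fun x => dualWedge e (f x) (g x) := by
  unfold MinkowskiPlane.dualWedge
  fun_prop

/-- The functional `wedge e x`. -/
noncomputable def wedgeLeft (x : V) : V →L[ℝ] ℝ :=
  LinearMap.toContinuousLinearMap
    { toFun := wedge e x
      map_add' := wedge_add_right e x
      map_smul' := fun r y => wedge_smul_right e r x y }

@[simp] lemma wedgeLeft_apply (x y : V) : wedgeLeft e x y = wedge e x y := rfl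

/-- Tilting `φ` by a multiple of `wedgeLeft e x` fixes its value at `x` and changes its determinant
with `ψ` by a multiple of `ψ x`. The corner argument rests on this. -/
lemma dualWedge_wedgeLeft (x : V) (ψ : V →L[ℝ] ℝ) : dualWedge e (wedgeLeft e x) ψ = -ψ x := by
  rw [apply_eq_repr e ψ x]
  simp [dualWedge, wedge]
  ring

lemma exists_functional {x y : V} (h : wedge e x y ≠ 0) (a b : ℝ) :
    ∃ φ : V →L[ℝ] ℝ, φ x = a ∧ φ y = b := by
  refine ⟨(wedge e x y)⁻¹ • (b • wedgeLeft e x - a • wedgeLeft e y), ?_, ?_⟩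
  · simp [wedge_self, wedge_swap e x y]; field_simp
  · simp [wedge_self]; field_simp

lemma exists_vectors {φ ψ : V →L[ℝ] ℝ} (h : dualWedge e φ ψ ≠ 0) (a b : ℝ) :
    ∃ x : V, φ x = a ∧ ψ x = b := by
  refine ⟨(dualWedge e φ ψ)⁻¹ • ((a * ψ (e 1) - b * φ (e 1)) • e 0 +
    (b * φ (e 0) - a * ψ (e 0)) • e 1), ?_, ?_⟩
  · simp only [map_smul, map_add, smul_eq_mul]
    field_simp; simp only [dualWedge]; ring
  · simp only [map_smul, map_add, smul_eq_mul]
    field_simp; simp only [dualWedge]; ring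

lemma linearIndependent_pair_of_wedge_ne_zero {x y : V} (h : wedge e x y ≠ 0) :
    LinearIndependent ℝ ![x, y] := by
  rw [LinearIndependent.pair_iff]
  intro s t hst
  have h1 := wedge_smul_add_smul_right e x y s t
  have h2 := wedge_left_smul_add_smul e x y s t
  rw [hst] at h1 h2
  simp only [wedge_zero_left, wedge_zero_right] at h1 h2
  exact ⟨by simpa [h] using h1.symm, by simpa [h] using h2.symm⟩

lemma wedge_ne_zero_of_linearIndependent {x y : V} (h : LinearIndependent ℝ ![x, y]) :
    wedge e x y ≠ 0 := by
  intro h0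
  have hx : x ≠ 0 := h.ne_zero 0
  obtain ⟨r, hr⟩ := exists_smul_of_wedge_eq_zero e hx h0
  rw [LinearIndependent.pair_iff] at h
  have := h r (-1) (by rw [hr]; simp)
  norm_num at this

variable [MeasurableSpace V] [BorelSpace V]

lemma addHaar_parallelepiped_pair (x y : V) :
    e.addHaar (parallelepiped ![x, y]) = ENNReal.ofReal |wedge e x y| := by
  rw [Measure.addHaar_parallelepiped, Module.Basis.det_apply, Matrix.det_fin_two]
  simp [Module.Basis.toMatrix_apply, wedge, mul_comm]

lemma measure_level_eq_zero (μ : Measure V) [μ.IsAddHaarMeasure] {φ : V →L[ℝ] ℝ} (hφ : φ ≠ 0)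
    (k : ℝ) : μ {v | φ v = k} = 0 := by
  by_cases hk : ∃ v, φ v = k
  · obtain ⟨v, hv⟩ := hk
    have h1 : {w | φ w = k} = (fun w => -v + w) ⁻¹' (LinearMap.ker φ.toLinearMap : Set V) := by
      ext w
      simp only [mem_ofPred_eq, mem_preimage, SetLike.mem_coe, LinearMap.mem_ker]
      change _ ↔ φ (-v + w) = 0
      rw [map_add, map_neg, hv]
      constructor <;> intro h <;> linarith
    rw [h1, measure_preimage_add]
    apply Measure.addHaar_submodule
    intro h
    apply hφ
    ext w
    have : w ∈ LinearMap.ker φ.toLinearMap := by rw [h]; trivial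
    exact this
  · have : {v | φ v = k} = ∅ := by
      ext v; simp only [mem_ofPred_eq, mem_empty_iff_false, iff_false]; exact fun h => hk ⟨v, h⟩
    rw [this, measure_empty]

lemma measure_wedge_level (μ : Measure V) [μ.IsAddHaarMeasure] {x : V} (hx : x ≠ 0) (k : ℝ) :
    μ {v | wedge e x v = k} = 0 := by
  refine measure_level_eq_zero μ (φ := wedgeLeft e x) ?_ k
  intro h
  have h1 : wedge e x (e 0) = 0 := by
    rw [← wedgeLeft_apply, h]; rfl
  have h2 : wedge e x (e 1) = 0 := by
    rw [← wedgeLeft_apply, h]; rfl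
  simp [wedge] at h1 h2
  apply hx
  rw [eq_repr_smul_add e x, h1, h2]; simp

end Wedge

/-! ### Circumscribed parallelograms as pairs of unit functionals -/

section Circumscribed

variable {V : Type*} [NormedAddCommGroup V] [NormedSpace ℝ V]

/-- The intersection of two strips symmetric about the origin. -/
def symmParallelogram (φ ψ : V →L[ℝ] ℝ) : Set V := {x | |φ x| ≤ 1 ∧ |ψ x| ≤ 1}

lemma mem_parallelogram {V : Type*} [AddCommGroup V] [Module ℝ V] {p u w v : V} :
    v ∈ parallelogram p u w ↔
      ∃ s t : ℝ, 0 ≤ s ∧ s ≤ 1 ∧ 0 ≤ t ∧ t ≤ 1 ∧ v = p + (s • u + t • w) := by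
  unfold parallelogram
  rw [mem_vadd_set]
  constructor
  · rintro ⟨y, hy, rfl⟩
    obtain ⟨s, t, h1, h2, h3, h4, rfl⟩ := mem_parallelepiped_pair.1 hy
    exact ⟨s, t, h1, h2, h3, h4, rfl⟩
  · rintro ⟨s, t, h1, h2, h3, h4, rfl⟩
    exact ⟨_, mem_parallelepiped_pair.2 ⟨s, t, h1, h2, h3, h4, rfl⟩, rfl⟩

lemma abs_apply_le_of_norm_le_one {φ : V →L[ℝ] ℝ} (hφ : ‖φ‖ ≤ 1) (x : V) : |φ x| ≤ ‖x‖ := by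
  have := φ.le_opNorm x
  rw [Real.norm_eq_abs] at this
  nlinarith [norm_nonneg x]

variable [FiniteDimensional ℝ V]

lemma exists_norm_eq_one_apply_eq_norm {φ : V →L[ℝ] ℝ} (hφ : φ ≠ 0) :
    ∃ z : V, ‖z‖ = 1 ∧ φ z = ‖φ‖ := by
  have : ProperSpace V := FiniteDimensional.proper ℝ V
  obtain ⟨z, hz, hmax⟩ := (isCompact_closedBall (0 : V) 1).exists_isMaxOn
    ⟨0, by simp⟩ φ.continuous.continuousOn
  have hz1 : ‖z‖ ≤ 1 := by simpa using hz
  have hmax' : ∀ y : V, ‖y‖ ≤ 1 → φ y ≤ φ z := fun y hy => hmax (by simpa using hy)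
  have h0 : 0 ≤ φ z := by simpa using hmax' 0 (by simp)
  have hle : ‖φ‖ ≤ φ z := by
    refine φ.opNorm_le_bound h0 fun x => ?_
    by_cases hx : x = 0
    · simp [hx]
    have hx' : 0 < ‖x‖ := norm_pos_iff.2 hx
    have h1 := hmax' (‖x‖⁻¹ • x) (by rw [norm_smul]; simp [hx'.ne'])
    have h2 := hmax' (-(‖x‖⁻¹ • x)) (by rw [norm_neg, norm_smul]; simp [hx'.ne'])
    simp only [map_smul, map_neg, smul_eq_mul] at h1 h2
    rw [Real.norm_eq_abs, abs_le]
    have h3 : φ x = ‖x‖ * (‖x‖⁻¹ * φ x) := by field_simp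
    constructor <;> rw [h3] <;> nlinarith
  have hpos : 0 < ‖φ‖ := norm_pos_iff.2 hφ
  have h4 : φ z ≤ ‖φ‖ * ‖z‖ := le_trans (le_abs_self _) (φ.le_opNorm z)
  have h5 : ‖z‖ = 1 := le_antisymm hz1 (by nlinarith)
  exact ⟨z, h5, le_antisymm (by simpa [h5] using h4) hle⟩

variable (e : Module.Basis (Fin 2) ℝ V)

lemma ne_zero_of_dualWedge_ne_zero {φ ψ : V →L[ℝ] ℝ} (h : dualWedge e φ ψ ≠ 0) :
    φ ≠ 0 ∧ ψ ≠ 0 := by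
  constructor <;> rintro rfl <;> simp [dualWedge] at h

lemma exists_symmParallelogram_eq {φ ψ : V →L[ℝ] ℝ} (h : dualWedge e φ ψ ≠ 0) :
    ∃ u v : V, φ u = 1 ∧ ψ u = 0 ∧ φ v = 0 ∧ ψ v = 1 ∧
      dualWedge e φ ψ * wedge e u v = 1 ∧
      symmParallelogram φ ψ = parallelogram (-(u + v)) ((2 : ℝ) • u) ((2 : ℝ) • v) := by
  obtain ⟨u, hu1, hu2⟩ := exists_vectors e h 1 0
  obtain ⟨v, hv1, hv2⟩ := exists_vectors e h 0 1
  have hw : dualWedge e φ ψ * wedge e u v = 1 := by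
    rw [dualWedge_mul_wedge, hu1, hu2, hv1, hv2]; ring
  refine ⟨u, v, hu1, hu2, hv1, hv2, hw, ?_⟩
  ext x
  rw [mem_parallelogram]
  have hx : x = φ x • u + ψ x • v := by
    have h0 : wedge e u v ≠ 0 := right_ne_zero_of_mul_eq_one hw
    have h1 := eq_smul_add_of_wedge_ne_zero e h0 x
    have h2 : φ x = wedge e x v / wedge e u v := by
      conv_lhs => rw [h1]
      simp [hu1, hv1]
    have h3 : ψ x = wedge e u x / wedge e u v := by
      conv_lhs => rw [h1]
      simp [hu2, hv2]
    rw [h2, h3]; exact h1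
  constructor
  · rintro ⟨h1, h2⟩
    rw [abs_le] at h1 h2
    refine ⟨(φ x + 1) / 2, (ψ x + 1) / 2, by linarith, by linarith, by linarith, by linarith, ?_⟩
    conv_lhs => rw [hx]
    module
  · rintro ⟨s, t, h1, h2, h3, h4, rfl⟩
    constructor <;>
    · simp only [map_add, map_neg, map_smul, smul_eq_mul, hu1, hu2, hv1, hv2]
      rw [abs_le]
      constructor <;> linarith

/-- The sides are touched at plus or minus the points where `φ` and `ψ` attain their norms. Letting
`K` lie between the circle and the disc serves both: `P` is circumscribed about the circle, while
equiframedness speaks of the disc. -/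
lemma isCircumscribed_symmParallelogram {K : Set V} (h1 : sphere (0 : V) 1 ⊆ K)
    (h2 : K ⊆ closedBall 0 1) {φ ψ : V →L[ℝ] ℝ} (hφ : ‖φ‖ = 1) (hψ : ‖ψ‖ = 1)
    (h : dualWedge e φ ψ ≠ 0) : IsCircumscribedParallelogram K (symmParallelogram φ ψ) := by
  obtain ⟨u, v, hu1, hu2, hv1, hv2, hw, heq⟩ := exists_symmParallelogram_eq e h
  have hw0 : wedge e u v ≠ 0 := right_ne_zero_of_mul_eq_one hw
  have hsub : ∀ x : V, ‖x‖ ≤ 1 → |φ x| ≤ 1 ∧ |ψ x| ≤ 1 := fun x hx =>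
    ⟨(abs_apply_le_of_norm_le_one hφ.le x).trans hx, (abs_apply_le_of_norm_le_one hψ.le x).trans hx⟩
  have hx : ∀ x : V, x = φ x • u + ψ x • v := by
    intro x
    have h1 := eq_smul_add_of_wedge_ne_zero e hw0 x
    have h2 : φ x = wedge e x v / wedge e u v := by
      conv_lhs => rw [h1]
      simp [hu1, hv1]
    have h3 : ψ x = wedge e u x / wedge e u v := by
      conv_lhs => rw [h1]
      simp [hu2, hv2]
    rw [h2, h3]; exact h1
  obtain ⟨y, hy, hφy⟩ := exists_norm_eq_one_apply_eq_norm (ne_zero_of_dualWedge_ne_zero e h).1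
  obtain ⟨z, hz, hψz⟩ := exists_norm_eq_one_apply_eq_norm (ne_zero_of_dualWedge_ne_zero e h).2
  rw [hφ] at hφy
  rw [hψ] at hψz
  have hyb := abs_le.1 (hsub y hy.le).2
  have hzb := abs_le.1 (hsub z hz.le).1
  refine ⟨-(u + v), (2 : ℝ) • u, (2 : ℝ) • v, ?_, heq, ?_, ?_, ?_, ?_, ?_⟩
  · apply linearIndependent_pair_of_wedge_ne_zero e
    simpa [wedge_smul_left, wedge_smul_right] using hw0
  · exact fun x hxK => hsub x (by simpa using h2 hxK)
  · refine ⟨-z, ⟨(1 + φ z) / 2, (1 - φ z) / 2, by linarith, by linarith, by ring, ?_⟩,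
      h1 (by simpa using hz)⟩
    conv_rhs => rw [hx z]
    rw [hψz]
    module
  · refine ⟨y, ⟨(1 - ψ y) / 2, (1 + ψ y) / 2, by linarith, by linarith, by ring, ?_⟩,
      h1 (by simpa using hy)⟩
    conv_rhs => rw [hx y]
    rw [hφy]
    module
  · refine ⟨z, ⟨(1 + φ z) / 2, (1 - φ z) / 2, by linarith, by linarith, by ring, ?_⟩,
      h1 (by simpa using hz)⟩
    conv_rhs => rw [hx z]
    rw [hψz]
    module
  · refine ⟨-y, ⟨(1 - ψ y) / 2, (1 + ψ y) / 2, by linarith, by linarith, by ring, ?_⟩,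
      h1 (by simpa using hy)⟩
    conv_rhs => rw [hx y]
    rw [hφy]
    module

/-- Reflecting the two touching points in the origin keeps them in the strip, which forces the strip
to be centred. The strip has width 1 in the values of `ψ`, hence the factor 2. -/
lemma norm_eq_one_of_touching {K : Set V} (h1 : sphere (0 : V) 1 ⊆ K)
    (h2 : K ⊆ closedBall 0 1) (hneg : ∀ x ∈ K, -x ∈ K) {ψ : V →L[ℝ] ℝ} {m : ℝ}
    (hK : ∀ x ∈ K, m ≤ ψ x ∧ ψ x ≤ m + 1)
    (hlow : ∃ x ∈ K, ψ x = m) (hup : ∃ x ∈ K, ψ x = m + 1) :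
    m = -(1 / 2) ∧ ‖(2 : ℝ) • ψ‖ = 1 := by
  obtain ⟨x, hx, hxm⟩ := hlow
  obtain ⟨y, hy, hym⟩ := hup
  have hx' := hK _ (hneg x hx)
  have hy' := hK _ (hneg y hy)
  rw [map_neg] at hx' hy'
  have hm : m = -(1 / 2) := by linarith
  refine ⟨hm, le_antisymm ?_ ?_⟩
  · refine ContinuousLinearMap.opNorm_le_of_unit_norm zero_le_one fun z hz => ?_
    have := hK z (h1 (by simpa using hz))
    rw [smul_apply, smul_eq_mul, Real.norm_eq_abs, abs_le]
    constructor <;> linarith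
  · have hy1 : ‖y‖ ≤ 1 := by simpa using h2 hy
    have := ((2 : ℝ) • ψ).le_opNorm y
    rw [smul_apply, smul_eq_mul, hym, hm, Real.norm_eq_abs] at this
    have h3 : |-(1 / 2 : ℝ) + 1| = 1 / 2 := by rw [abs_of_pos] <;> norm_num
    rw [← smul_eq_mul, ← smul_eq_mul] at this
    have h0 := norm_nonneg ((2 : ℝ) • ψ)
    rw [smul_eq_mul, smul_eq_mul, abs_mul, h3] at this
    norm_num only at this
    nlinarith

/-- The functionals are the coordinates along the two edge vectors, doubled. Both strips are centred
by `norm_eq_one_of_touching`. -/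
lemma exists_eq_symmParallelogram {K P : Set V} (h1 : sphere (0 : V) 1 ⊆ K)
    (h2 : K ⊆ closedBall 0 1) (hneg : ∀ x ∈ K, -x ∈ K) (hP : IsCircumscribedParallelogram K P) :
    ∃ φ ψ : V →L[ℝ] ℝ, ‖φ‖ = 1 ∧ ‖ψ‖ = 1 ∧ dualWedge e φ ψ ≠ 0 ∧ P = symmParallelogram φ ψ := by
  obtain ⟨p, u, v, hli, rfl, hKP, hb, hr, ht, hl⟩ := hP
  have hw := wedge_ne_zero_of_linearIndependent e hli
  obtain ⟨φ, hφu, hφv⟩ := exists_functional e hw 1 0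
  obtain ⟨ψ, hψu, hψv⟩ := exists_functional e hw 0 1
  have key : ∀ x ∈ K, (φ p ≤ φ x ∧ φ x ≤ φ p + 1) ∧ (ψ p ≤ ψ x ∧ ψ x ≤ ψ p + 1) := by
    intro x hx
    obtain ⟨s, t, h1, h2, h3, h4, rfl⟩ := mem_parallelogram.1 (hKP hx)
    simp only [map_add, map_smul, smul_eq_mul, hφu, hφv, hψu, hψv]
    refine ⟨⟨?_, ?_⟩, ?_, ?_⟩ <;> linarith
  have hφ := norm_eq_one_of_touching h1 h2 hneg (fun x hx => (key x hx).1)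
    (by
      obtain ⟨x, ⟨a, b, _, _, hab, rfl⟩, hx⟩ := hl
      exact ⟨_, hx, by simp only [map_add, map_smul, smul_eq_mul, hφv]; linear_combination φ p * hab⟩)
    (by
      obtain ⟨x, ⟨a, b, _, _, hab, rfl⟩, hx⟩ := hr
      exact ⟨_, hx, by
        simp only [map_add, map_smul, smul_eq_mul, hφu, hφv]; linear_combination (φ p + 1) * hab⟩)
  have hψ := norm_eq_one_of_touching h1 h2 hneg (fun x hx => (key x hx).2)
    (by
      obtain ⟨x, ⟨a, b, _, _, hab, rfl⟩, hx⟩ := hb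
      exact ⟨_, hx, by simp only [map_add, map_smul, smul_eq_mul, hψu]; linear_combination ψ p * hab⟩)
    (by
      obtain ⟨x, ⟨a, b, _, _, hab, rfl⟩, hx⟩ := ht
      exact ⟨_, hx, by
        simp only [map_add, map_smul, smul_eq_mul, hψu, hψv]; linear_combination (ψ p + 1) * hab⟩)
  refine ⟨(2 : ℝ) • φ, (2 : ℝ) • ψ, hφ.2, hψ.2, ?_, ?_⟩
  · rw [dualWedge_smul_left, dualWedge_smul_right]
    have := dualWedge_mul_wedge e φ ψ u v
    rw [hφu, hφv, hψu, hψv] at this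
    have h0 : dualWedge e φ ψ ≠ 0 := by
      intro h0; rw [h0] at this; norm_num at this
    positivity
  · ext x
    rw [mem_parallelogram]
    constructor
    · rintro ⟨s, t, h1, h2, h3, h4, rfl⟩
      constructor <;>
      · simp only [smul_apply, map_add, map_smul, smul_eq_mul, hφu, hφv, hψu, hψv, hφ.1, hψ.1]
        rw [abs_le]
        constructor <;> linarith
    · rintro ⟨h1, h2⟩
      simp only [smul_apply, smul_eq_mul, abs_le] at h1 h2
      refine ⟨φ (x - p), ψ (x - p), ?_, ?_, ?_, ?_, ?_⟩
      · rw [map_sub]; linarith [hφ.1]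
      · rw [map_sub]; linarith [hφ.1]
      · rw [map_sub]; linarith [hψ.1]
      · rw [map_sub]; linarith [hψ.1]
      have h3 := eq_smul_add_of_wedge_ne_zero e hw (x - p)
      have h4 : φ (x - p) = wedge e (x - p) v / wedge e u v := by
        conv_lhs => rw [h3]
        rw [map_add, map_smul, map_smul, hφu, hφv]; simp
      have h5 : ψ (x - p) = wedge e u (x - p) / wedge e u v := by
        conv_lhs => rw [h3]
        rw [map_add, map_smul, map_smul, hψu, hψv]; simp
      rw [h4, h5, ← h3]
      abel

variable [MeasurableSpace V] [BorelSpace V]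

lemma addHaar_symmParallelogram {φ ψ : V →L[ℝ] ℝ} (h : dualWedge e φ ψ ≠ 0) :
    e.addHaar (symmParallelogram φ ψ) = ENNReal.ofReal (4 / |dualWedge e φ ψ|) := by
  obtain ⟨u, v, -, -, -, -, hw, heq⟩ := exists_symmParallelogram_eq e h
  rw [heq, parallelogram, measure_vadd, addHaar_parallelepiped_pair, wedge_smul_left,
    wedge_smul_right, eq_one_div_of_mul_eq_one_right hw]
  congr 1
  rw [← mul_assoc, abs_mul, abs_div, abs_one]
  norm_num
  rfl

/-- The basis is dual to functionals of norm at most one whose determinant is maximal among the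
pairs of functionals of norm at most one. -/
structure IsExtremal (e : Module.Basis (Fin 2) ℝ V) : Prop where
  abs_dualWedge_le : ∀ φ ψ : V →L[ℝ] ℝ, |dualWedge e φ ψ| ≤ ‖φ‖ * ‖ψ‖
  abs_repr_le : ∀ (x : V) (i : Fin 2), |e.repr x i| ≤ ‖x‖

lemma exists_eq_smul_addHaar (μ : Measure V) [μ.IsAddHaarMeasure] :
    ∃ c : ENNReal, c ≠ 0 ∧ c ≠ ⊤ ∧ μ = c • e.addHaar := by
  refine ⟨Measure.addHaarScalarFactor μ e.addHaar, ?_, ENNReal.coe_ne_top, ?_⟩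
  · exact_mod_cast (Measure.addHaarScalarFactor_pos_of_isAddHaarMeasure μ e.addHaar).ne'
  · exact Measure.isAddLeftInvariant_eq_smul μ e.addHaar

lemma abs_dualWedge_le_of_unit
    (h : ∀ φ ψ : V →L[ℝ] ℝ, ‖φ‖ = 1 → ‖ψ‖ = 1 → |dualWedge e φ ψ| ≤ 1) (φ ψ : V →L[ℝ] ℝ) :
    |dualWedge e φ ψ| ≤ ‖φ‖ * ‖ψ‖ := by
  by_cases hφ : φ = 0
  · simp [hφ, dualWedge]
  by_cases hψ : ψ = 0
  · simp [hψ, dualWedge]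
  have hφ' : 0 < ‖φ‖ := norm_pos_iff.2 hφ
  have hψ' : 0 < ‖ψ‖ := norm_pos_iff.2 hψ
  have := h (‖φ‖⁻¹ • φ) (‖ψ‖⁻¹ • ψ) (by rw [norm_smul]; simp [hφ'.ne'])
    (by rw [norm_smul]; simp [hψ'.ne'])
  rw [dualWedge_smul_left, dualWedge_smul_right, abs_mul, abs_mul, abs_of_pos (inv_pos.2 hφ'),
    abs_of_pos (inv_pos.2 hψ')] at this
  field_simp at this
  linarith

lemma IsMinCircumscribedParallelogram.exists_isExtremal
    (e : Module.Basis (Fin 2) ℝ V) {μ : Measure V} [μ.IsAddHaarMeasure]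
    {K P : Set V} (h1 : sphere (0 : V) 1 ⊆ K) (h2 : K ⊆ closedBall 0 1)
    (hneg : ∀ x ∈ K, -x ∈ K) (hP : IsMinCircumscribedParallelogram μ K P) :
    ∃ e' : Module.Basis (Fin 2) ℝ V, IsExtremal e' ∧ e'.addHaar P = 4 := by
  obtain ⟨φ, ψ, hφ, hψ, hd, rfl⟩ := exists_eq_symmParallelogram e h1 h2 hneg hP.1
  obtain ⟨u, v, hu1, hu2, hv1, hv2, hw, -⟩ := exists_symmParallelogram_eq e hd
  have hli := linearIndependent_pair_of_wedge_ne_zero e (right_ne_zero_of_mul_eq_one hw)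
  have hcard : Fintype.card (Fin 2) = Module.finrank ℝ V := by
    rw [Module.finrank_eq_card_basis e]
  -- The basis dual to `φ, ψ`: it normalises the maximal determinant to 1, and so the minimal area
  -- to 4.
  let b := basisOfLinearIndependentOfCardEqFinrank hli hcard
  have hb0 : b 0 = u := by simp [b]
  have hb1 : b 1 = v := by simp [b]
  have hone : dualWedge b φ ψ = 1 := by
    rw [dualWedge, hb0, hb1, hu1, hu2, hv1, hv2]; ring
  have hPb : b.addHaar (symmParallelogram φ ψ) = 4 := by
    rw [addHaar_symmParallelogram b (by rw [hone]; exact one_ne_zero), hone]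
    norm_num
  refine ⟨b, ⟨abs_dualWedge_le_of_unit b ?_, ?_⟩, hPb⟩
  · intro φ' ψ' hφ' hψ'
    by_cases h0 : dualWedge b φ' ψ' = 0
    · rw [h0]; simp
    have hle := hP.2 _ (isCircumscribed_symmParallelogram b h1 h2 hφ' hψ' h0)
    obtain ⟨c, hc0, hct, rfl⟩ := exists_eq_smul_addHaar b μ
    rw [Measure.smul_apply, Measure.smul_apply, hPb, addHaar_symmParallelogram b h0, smul_eq_mul,
      smul_eq_mul, ENNReal.mul_le_mul_iff_right hc0 hct] at hle
    rw [show (4 : ENNReal) = ENNReal.ofReal 4 by norm_num] at hle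
    have hpos : 0 < |dualWedge b φ' ψ'| := abs_pos.2 h0
    rw [ENNReal.ofReal_le_ofReal_iff (by positivity), le_div_iff₀ hpos] at hle
    linarith
  · intro x i
    have h3 := apply_eq_repr b φ x
    have h4 := apply_eq_repr b ψ x
    rw [hb0, hb1, hu1, hv1] at h3
    rw [hb0, hb1, hu2, hv2] at h4
    fin_cases i
    · simpa [h3] using abs_apply_le_of_norm_le_one hφ.le x
    · simpa [h4] using abs_apply_le_of_norm_le_one hψ.le x

/-- A unit vector supported by a functional belonging to a pair with maximal determinant. -/
def IsFramed (e : Module.Basis (Fin 2) ℝ V) (z : V) : Prop :=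
  ∃ φ ψ : V →L[ℝ] ℝ, ‖φ‖ ≤ 1 ∧ ‖ψ‖ ≤ 1 ∧ φ z = 1 ∧ |dualWedge e φ ψ| = 1

variable {e}

lemma IsExtremal.measure_ge (he : IsExtremal e) {φ ψ : V →L[ℝ] ℝ} (hφ : ‖φ‖ = 1) (hψ : ‖ψ‖ = 1)
    (h : dualWedge e φ ψ ≠ 0) : 4 ≤ e.addHaar (symmParallelogram φ ψ) := by
  rw [addHaar_symmParallelogram e h, show (4 : ENNReal) = ENNReal.ofReal 4 by norm_num]
  apply ENNReal.ofReal_le_ofReal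
  have h1 := he.abs_dualWedge_le φ ψ
  rw [hφ, hψ] at h1
  rw [le_div_iff₀ (abs_pos.2 h)]
  linarith

lemma frontier_closedBall_one (V : Type*) [NormedAddCommGroup V] [NormedSpace ℝ V] :
    frontier (closedBall (0 : V) 1) = sphere 0 1 :=
  frontier_closedBall 0 one_ne_zero

/-- Changing the Haar measure only rescales all areas, and `P` shows that the minimum 4 is attained;
so a circumscribed parallelogram is minimal exactly when its functionals have determinant `±1`. A
point of the disc lies on its boundary exactly when one of the two functionals is `±1` there, and
signs and order can be adjusted. -/
lemma isEquiframed_iff (he : IsExtremal e) (μ : Measure V) [μ.IsAddHaarMeasure] {P : Set V}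
    (hP : IsCircumscribedParallelogram (sphere (0 : V) 1) P) (hP4 : e.addHaar P = 4) :
    IsEquiframed μ (closedBall (0 : V) 1) ↔ ∀ z : V, ‖z‖ = 1 → IsFramed e z := by
  have hsub : sphere (0 : V) 1 ⊆ closedBall 0 1 := sphere_subset_closedBall
  have hneg : ∀ x ∈ closedBall (0 : V) 1, -x ∈ closedBall (0 : V) 1 := by simp
  have hneg' : ∀ x ∈ sphere (0 : V) 1, -x ∈ sphere (0 : V) 1 := by simp
  obtain ⟨c, hc0, hct, rfl⟩ := exists_eq_smul_addHaar e μ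
  obtain ⟨f, g, hf, hg, hfg, rfl⟩ := exists_eq_symmParallelogram e subset_rfl hsub hneg' hP
  unfold IsEquiframed
  rw [frontier_closedBall_one]
  constructor
  · intro h z hz
    obtain ⟨Q, hQ, hzQ⟩ := h z (by simpa using hz)
    obtain ⟨φ, ψ, hφ, hψ, hd, rfl⟩ := exists_eq_symmParallelogram e hsub subset_rfl hneg hQ.1
    have hle := hQ.2 _ (isCircumscribed_symmParallelogram e hsub subset_rfl hf hg hfg)
    rw [Measure.smul_apply, Measure.smul_apply, hP4, addHaar_symmParallelogram e hd, smul_eq_mul,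
      smul_eq_mul, ENNReal.mul_le_mul_iff_right hc0 hct,
      show (4 : ENNReal) = ENNReal.ofReal 4 by norm_num,
      ENNReal.ofReal_le_ofReal_iff (by norm_num), div_le_iff₀ (abs_pos.2 hd)] at hle
    have hle' := he.abs_dualWedge_le φ ψ
    rw [hφ, hψ] at hle'
    have hone : |dualWedge e φ ψ| = 1 := by linarith
    have hcases : |φ z| = 1 ∨ |ψ z| = 1 := by
      by_contra! hcon
      have h1 := abs_apply_le_of_norm_le_one hφ.le z
      have h2 := abs_apply_le_of_norm_le_one hψ.le z
      rw [hz] at h1 h2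
      have hopen : IsOpen {x : V | |φ x| < 1 ∧ |ψ x| < 1} :=
        (isOpen_lt φ.continuous.abs continuous_const).inter
          (isOpen_lt ψ.continuous.abs continuous_const)
      have hmem : z ∈ interior (symmParallelogram φ ψ) :=
        mem_interior.2 ⟨{x : V | |φ x| < 1 ∧ |ψ x| < 1}, fun x hx => ⟨hx.1.le, hx.2.le⟩, hopen,
          lt_of_le_of_ne h1 hcon.1, lt_of_le_of_ne h2 hcon.2⟩
      exact hzQ.2 hmem
    rcases hcases with h1 | h1 <;> rcases (abs_eq zero_le_one).1 h1 with h2 | h2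
    · exact ⟨φ, ψ, hφ.le, hψ.le, h2, hone⟩
    · exact ⟨-φ, ψ, by rw [norm_neg]; exact hφ.le, hψ.le, by simp [h2],
        by rw [dualWedge_neg_left, abs_neg, hone]⟩
    · exact ⟨ψ, φ, hψ.le, hφ.le, h2, by rw [dualWedge_swap, abs_neg, hone]⟩
    · exact ⟨-ψ, φ, by rw [norm_neg]; exact hψ.le, hφ.le, by simp [h2],
        by rw [dualWedge_neg_left, abs_neg, dualWedge_swap, abs_neg, hone]⟩
  · intro h z hz
    have hz1 : ‖z‖ = 1 := by simpa using hz
    obtain ⟨φ, ψ, hφ, hψ, hφz, hone⟩ := h z hz1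
    have hle := he.abs_dualWedge_le φ ψ
    rw [hone] at hle
    -- A framing pair has norms at most 1 and determinant `±1`; since the norms multiply to at least
    -- 1, both are equal to 1.
    have hφ1 : ‖φ‖ = 1 := le_antisymm hφ (by nlinarith [norm_nonneg φ, norm_nonneg ψ])
    have hψ1 : ‖ψ‖ = 1 := le_antisymm hψ (by nlinarith [norm_nonneg φ, norm_nonneg ψ])
    have hd : dualWedge e φ ψ ≠ 0 := by
      intro h0; rw [h0] at hone; norm_num at hone
    refine ⟨symmParallelogram φ ψ,
      ⟨isCircumscribed_symmParallelogram e hsub subset_rfl hφ1 hψ1 hd, ?_⟩, ?_⟩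
    · intro Q hQ
      obtain ⟨φ', ψ', hφ', hψ', hd', rfl⟩ := exists_eq_symmParallelogram e hsub subset_rfl hneg hQ
      rw [Measure.smul_apply, Measure.smul_apply, addHaar_symmParallelogram e hd, hone]
      refine mul_le_mul_right ?_ _
      norm_num
      exact he.measure_ge hφ' hψ' hd'
    · have hzQ : z ∈ symmParallelogram φ ψ := by
        refine ⟨by rw [hφz]; simp, ?_⟩
        simpa [hz1] using abs_apply_le_of_norm_le_one hψ z
      refine ⟨subset_closure hzQ, fun hint => ?_⟩
      -- If `z` were interior, a slightly longer multiple of it would still satisfy `|φ| ≤ 1`,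
      -- although `φ z = 1`.
      have hcont : ContinuousAt (fun r : ℝ => r • z) 1 := by fun_prop
      have hev := hcont.preimage_mem_nhds (t := symmParallelogram φ ψ)
        (by simpa using mem_interior_iff_mem_nhds.1 hint)
      obtain ⟨ε, hε, hball⟩ := Metric.mem_nhds_iff.1 hev
      have hmem : (1 + ε / 2) ∈ ball (1 : ℝ) ε := by
        rw [mem_ball, Real.dist_eq]; ring_nf; rw [abs_of_pos] <;> linarith
      have h1 := (hball hmem).1
      simp only [map_smul, hφz, smul_eq_mul, mul_one] at h1
      linarith [le_abs_self (1 + ε / 2)]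

end Circumscribed

/-! ### Triangles, sectors, and the chord estimate -/

section Cones

variable {V : Type*} [NormedAddCommGroup V] [NormedSpace ℝ V]

/-- The closed triangle with vertices `0`, `x`, `y`. -/
def triangle (x y : V) : Set V :=
  {v | ∃ s t : ℝ, 0 ≤ s ∧ 0 ≤ t ∧ s + t ≤ 1 ∧ v = s • x + t • y}

/-- The open triangle with vertices `0`, `x`, `y`. -/
def openTriangle (x y : V) : Set V :=
  {v | ∃ s t : ℝ, 0 < s ∧ 0 < t ∧ s + t < 1 ∧ v = s • x + t • y}

/-- The open cone spanned by two vectors. -/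
def openCone (x y : V) : Set V := {v | ∃ s t : ℝ, 0 < s ∧ 0 < t ∧ v = s • x + t • y}

lemma openTriangle_subset_triangle (x y : V) : openTriangle x y ⊆ triangle x y := by
  rintro v ⟨s, t, h1, h2, h3, rfl⟩
  exact ⟨s, t, h1.le, h2.le, h3.le, rfl⟩

lemma openTriangle_subset_openCone (x y : V) : openTriangle x y ⊆ openCone x y := by
  rintro v ⟨s, t, h1, h2, h3, rfl⟩
  exact ⟨s, t, h1, h2, rfl⟩

lemma Convex.triangle_subset {X : Set V} (hX : Convex ℝ X) {x y : V} (h0 : (0 : V) ∈ X)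
    (hx : x ∈ X) (hy : y ∈ X) : triangle x y ⊆ X := by
  rintro v ⟨s, t, hs, ht, hst, rfl⟩
  rcases (add_nonneg hs ht).eq_or_lt with h | h
  · have h1 : s = 0 := by linarith
    have h2 : t = 0 := by linarith
    simpa [h1, h2] using h0
  · have h1 : (s / (s + t)) • x + (t / (s + t)) • y ∈ X :=
      hX hx hy (by positivity) (by positivity) (by field_simp)
    have h2 := hX.smul_mem_of_zero_mem h0 h1 ⟨h.le, hst⟩
    rw [smul_add, smul_smul, smul_smul, mul_div_cancel₀ _ h.ne', mul_div_cancel₀ _ h.ne'] at h2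
    exact h2

lemma exists_supporting_functional (v : V) : ∃ ψ : V →L[ℝ] ℝ, ‖ψ‖ ≤ 1 ∧ ψ v = ‖v‖ := by
  obtain ⟨g, hg, hgv⟩ := exists_dual_vector'' ℝ v
  exact ⟨g, hg, by simpa using hgv⟩

/-- If `t ≤ 0`, the triangle inequality gives `s ≤ 1 - t`. Hence points of the disc strictly beyond
the line of a chord lie in the cone over that chord. -/
lemma pos_of_one_lt_add {x y : V} (hx : ‖x‖ = 1) (hy : ‖y‖ = 1) {s t : ℝ}
    (hv : ‖s • x + t • y‖ ≤ 1) (hst : 1 < s + t) : 0 < s ∧ 0 < t := by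
  have key : ∀ (x y : V) (s t : ℝ), ‖x‖ = 1 → ‖y‖ = 1 → ‖s • x + t • y‖ ≤ 1 → 1 < s + t → 0 < t := by
    intro x y s t hx hy hv hst
    by_contra! ht
    have h1 : ‖s • x‖ ≤ ‖s • x + t • y‖ + ‖t • y‖ := by
      have := norm_sub_le (s • x + t • y) (t • y)
      rwa [add_sub_cancel_right] at this
    rw [norm_smul, norm_smul, hx, hy, Real.norm_eq_abs, Real.norm_eq_abs, abs_of_nonpos ht] at h1
    linarith [le_abs_self s]
  exact ⟨key y x t s hy hx (by rwa [add_comm]) (by rwa [add_comm]), key x y s t hx hy hv hst⟩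

variable (e : Module.Basis (Fin 2) ℝ V)

lemma mem_openCone_iff {x y v : V} (h : wedge e x y ≠ 0) :
    v ∈ openCone x y ↔ 0 < wedge e v y / wedge e x y ∧ 0 < wedge e x v / wedge e x y := by
  constructor
  · rintro ⟨s, t, hs, ht, rfl⟩
    rw [wedge_smul_add_smul_right, wedge_left_smul_add_smul, mul_div_cancel_right₀ _ h,
      mul_div_cancel_right₀ _ h]
    exact ⟨hs, ht⟩
  · rintro ⟨hs, ht⟩
    exact ⟨_, _, hs, ht, eq_smul_add_of_wedge_ne_zero e h v⟩

lemma mem_openTriangle_iff {x y v : V} (h : wedge e x y ≠ 0) :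
    v ∈ openTriangle x y ↔ 0 < wedge e v y / wedge e x y ∧ 0 < wedge e x v / wedge e x y ∧
      wedge e v y / wedge e x y + wedge e x v / wedge e x y < 1 := by
  constructor
  · rintro ⟨s, t, hs, ht, hst, rfl⟩
    rw [wedge_smul_add_smul_right, wedge_left_smul_add_smul, mul_div_cancel_right₀ _ h,
      mul_div_cancel_right₀ _ h]
    exact ⟨hs, ht, hst⟩
  · rintro ⟨hs, ht, hst⟩
    exact ⟨_, _, hs, ht, hst, eq_smul_add_of_wedge_ne_zero e h v⟩

variable [FiniteDimensional ℝ V]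

lemma isOpen_openCone {x y : V} (h : wedge e x y ≠ 0) : IsOpen (openCone x y) := by
  have : openCone x y =
      {v | 0 < wedge e v y / wedge e x y} ∩ {v | 0 < wedge e x v / wedge e x y} := by
    ext v; exact mem_openCone_iff e h
  rw [this]
  exact (isOpen_lt continuous_const ((Continuous.wedge e continuous_id continuous_const).div_const _)).inter
    (isOpen_lt continuous_const ((Continuous.wedge e continuous_const continuous_id).div_const _))

lemma isOpen_openTriangle {x y : V} (h : wedge e x y ≠ 0) : IsOpen (openTriangle x y) := by
  have h1 := (Continuous.wedge e continuous_id (continuous_const (y := y))).div_const (wedge e x y)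
  have h2 := (Continuous.wedge e (continuous_const (y := x)) continuous_id).div_const (wedge e x y)
  have : openTriangle x y =
      {v | 0 < wedge e v y / wedge e x y} ∩ ({v | 0 < wedge e x v / wedge e x y} ∩
        {v | wedge e v y / wedge e x y + wedge e x v / wedge e x y < 1}) := by
    ext v; exact mem_openTriangle_iff e h
  rw [this]
  exact (isOpen_lt continuous_const h1).inter
    ((isOpen_lt continuous_const h2).inter (isOpen_lt (h1.add h2) continuous_const))

variable [MeasurableSpace V] [BorelSpace V]

lemma measure_preimage_reflection (μ : Measure V) [μ.IsAddHaarMeasure] (a : V) (X : Set V) :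
    μ ((fun v => a - v) ⁻¹' X) = μ X := by
  have : (fun v => a - v) ⁻¹' X = (fun v => -a + v) ⁻¹' (-X) := by
    ext v
    simp only [mem_preimage, Set.mem_neg, neg_add, neg_neg, sub_eq_add_neg]
  rw [this, measure_preimage_add, Measure.measure_neg]

/-- The reflection `v ↦ x + y - v` exchanges the two halves of the parallelogram. Two open halves
are disjoint inside it and two closed halves cover it; open and closed halves differ by null lines.
-/
lemma measure_triangles {x y : V} (h : wedge e x y ≠ 0) :
    e.addHaar (openTriangle x y) = ENNReal.ofReal (|wedge e x y| / 2) ∧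
      e.addHaar (triangle x y) = ENNReal.ofReal (|wedge e x y| / 2) := by
  set w := wedge e x y with hw
  have hx0 : x ≠ 0 := by rintro rfl; exact h (by rw [hw, wedge_zero_left])
  have hy0 : y ≠ 0 := by rintro rfl; exact h (by rw [hw, wedge_zero_right])
  have hxy0 : x - y ≠ 0 := by
    intro h0; rw [sub_eq_zero] at h0; subst h0; exact h (by rw [hw, wedge_self])
  have hle : e.addHaar (triangle x y) ≤ e.addHaar (openTriangle x y) := by
    have hsub : triangle x y ⊆ openTriangle x y ∪
        ({v | wedge e x v = 0} ∪ ({v | wedge e y v = 0} ∪ {v | wedge e (x - y) v = w})) := by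
      rintro v ⟨s, t, hs, ht, hst, rfl⟩
      rcases hs.eq_or_lt with rfl | hs
      · right; right; left
        simp [wedge_smul_right, wedge_self]
      rcases ht.eq_or_lt with rfl | ht
      · right; left
        simp [wedge_smul_right, wedge_self]
      rcases hst.eq_or_lt with hst | hst
      · right; right; right
        simp only [mem_ofPred_eq, wedge_sub_left, wedge_add_right, wedge_smul_right, wedge_self,
          wedge_swap e x y, ← hw]
        linear_combination w * hst
      · left; exact ⟨s, t, hs, ht, hst, rfl⟩
    refine (measure_mono hsub).trans ((measure_union_le _ _).trans ?_)
    rw [measure_union_null (measure_wedge_level e _ hx0 _)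
      (measure_union_null (measure_wedge_level e _ hy0 _) (measure_wedge_level e _ hxy0 _)), add_zero]
  have hupper : e.addHaar (openTriangle x y) * 2 ≤ ENNReal.ofReal |w| := by
    rw [← addHaar_parallelepiped_pair, mul_two]
    nth_rewrite 2 [← measure_preimage_reflection e.addHaar (x + y) (openTriangle x y)]
    have hmeas : MeasurableSet ((fun v => x + y - v) ⁻¹' openTriangle x y) :=
      ((isOpen_openTriangle e h).preimage (by fun_prop)).measurableSet
    rw [← measure_union _ hmeas]
    · apply measure_mono
      rintro v (⟨s, t, hs, ht, hst, rfl⟩ | ⟨s, t, hs, ht, hst, hv⟩)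
      · exact mem_parallelepiped_pair.2
          ⟨s, t, hs.le, by linarith, ht.le, by linarith, rfl⟩
      · refine mem_parallelepiped_pair.2
          ⟨1 - s, 1 - t, by linarith, by linarith, by linarith, by linarith, ?_⟩
        rw [sub_eq_iff_eq_add] at hv
        rw [← sub_eq_iff_eq_add'] at hv
        rw [← hv]; module
    · rw [Set.disjoint_left]
      intro v hv hv'
      rw [mem_preimage, mem_openTriangle_iff e h] at hv'
      rw [mem_openTriangle_iff e h] at hv
      have h1 : wedge e (x + y - v) y / wedge e x y = 1 - wedge e v y / wedge e x y := by
        rw [wedge_sub_left, wedge_add_left, wedge_self, add_zero, sub_div, div_self h]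
      have h2 : wedge e x (x + y - v) / wedge e x y = 1 - wedge e x v / wedge e x y := by
        rw [wedge_sub_right, wedge_add_right, wedge_self, zero_add, sub_div, div_self h]
      rw [h1, h2] at hv'
      linarith [hv.2.2, hv'.2.2]
  have hlower : ENNReal.ofReal |w| ≤ e.addHaar (triangle x y) * 2 := by
    rw [← addHaar_parallelepiped_pair, mul_two]
    nth_rewrite 2 [← measure_preimage_reflection e.addHaar (x + y) (triangle x y)]
    refine le_trans (measure_mono ?_) (measure_union_le _ _)
    intro v hv
    obtain ⟨s, t, h1, h2, h3, h4, rfl⟩ := mem_parallelepiped_pair.1 hv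
    by_cases hst : s + t ≤ 1
    · left; exact ⟨s, t, h1, h3, hst, rfl⟩
    · right; exact ⟨1 - s, 1 - t, by linarith, by linarith, by linarith, by module⟩
  have hdiv : ENNReal.ofReal (|w| / 2) = ENNReal.ofReal |w| / 2 := by
    rw [ENNReal.ofReal_div_of_pos two_pos]; simp
  rw [hdiv]
  have h2 : (2 : ENNReal) ≠ 0 := two_ne_zero
  have h2' : (2 : ENNReal) ≠ ⊤ := ENNReal.ofNat_ne_top
  have hO : e.addHaar (openTriangle x y) ≤ ENNReal.ofReal |w| / 2 := by
    rwa [ENNReal.le_div_iff_mul_le (Or.inl h2) (Or.inl h2')]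
  have hT : ENNReal.ofReal |w| / 2 ≤ e.addHaar (triangle x y) := by
    rwa [ENNReal.div_le_iff_le_mul (Or.inl h2) (Or.inl h2')]
  exact ⟨le_antisymm hO (hT.trans hle), le_antisymm (hle.trans hO) hT⟩

lemma Convex.measure_inter_openCone_ge {X : Set V} (hX : Convex ℝ X) (h0 : (0 : V) ∈ X) {x y : V}
    (h : wedge e x y ≠ 0) (hx : x ∈ X) (hy : y ∈ X) :
    ENNReal.ofReal (|wedge e x y| / 2) ≤ e.addHaar (X ∩ openCone x y) := by
  rw [← (measure_triangles e h).1]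
  exact measure_mono (subset_inter ((openTriangle_subset_triangle x y).trans
    (Convex.triangle_subset hX h0 hx hy)) (openTriangle_subset_openCone x y))

/-- The point `z` splits the cone into two disjoint cones, and the triangles `0xz` and `0zy` have
determinants `t (x ∧ y)` and `s (x ∧ y)`. -/
lemma Convex.measure_inter_openCone_ge_of_mem {X : Set V} (hX : Convex ℝ X) (h0 : (0 : V) ∈ X)
    {x y : V} (h : wedge e x y ≠ 0) (hx : x ∈ X) (hy : y ∈ X) {s t : ℝ} (hs : 0 < s) (ht : 0 < t)
    (hz : s • x + t • y ∈ X) :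
    ENNReal.ofReal ((s + t) * |wedge e x y| / 2) ≤ e.addHaar (X ∩ openCone x y) := by
  set z := s • x + t • y with hzdef
  have h1 : wedge e x z = t * wedge e x y := wedge_left_smul_add_smul e x y s t
  have h2 : wedge e z y = s * wedge e x y := wedge_smul_add_smul_right e x y s t
  have h1' : wedge e x z ≠ 0 := by rw [h1]; exact mul_ne_zero ht.ne' h
  have h2' : wedge e z y ≠ 0 := by rw [h2]; exact mul_ne_zero hs.ne' h
  have hA := Convex.measure_inter_openCone_ge e hX h0 h1' hx hz
  have hB := Convex.measure_inter_openCone_ge e hX h0 h2' hz hy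
  have hsum : ENNReal.ofReal ((s + t) * |wedge e x y| / 2) =
      ENNReal.ofReal (|wedge e x z| / 2) + ENNReal.ofReal (|wedge e z y| / 2) := by
    rw [← ENNReal.ofReal_add (by positivity) (by positivity), h1, h2, abs_mul, abs_mul,
      abs_of_pos hs, abs_of_pos ht]
    congr 1; ring
  have hdisj : Disjoint (openCone x z) (openCone z y) := by
    rw [Set.disjoint_left]
    rintro v ⟨a, b, ha, hb, rfl⟩ ⟨c, d, hc, hd, hv⟩
    have hv1 := congrArg (wedge e z) hv
    simp only [wedge_add_right, wedge_smul_right, wedge_self, wedge_swap e x z, h1, h2] at hv1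
    have hv2 : (a * t + d * s) * wedge e x y = 0 := by linear_combination -hv1
    rcases mul_eq_zero.1 hv2 with h3 | h3
    · nlinarith [mul_pos ha ht, mul_pos hd hs]
    · exact h h3
  rw [hsum]
  refine (add_le_add hA hB).trans ?_
  have hO : MeasurableSet (openCone z y) := (isOpen_openCone e h2').measurableSet
  have hd' : Disjoint (X ∩ openCone x z) (X ∩ openCone z y) :=
    hdisj.mono inter_subset_right inter_subset_right
  have hle : e.addHaar (X ∩ openCone x z) + e.addHaar (X ∩ openCone z y) ≤
      e.addHaar (X ∩ (openCone x z ∪ openCone z y)) := by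
    rw [← measure_inter_add_sdiff (X ∩ (openCone x z ∪ openCone z y)) hO, add_comm]
    refine add_le_add (measure_mono ?_) (measure_mono ?_)
    · exact fun v hv => ⟨⟨hv.1, Or.inr hv.2⟩, hv.2⟩
    · exact fun v hv => ⟨⟨hv.1, Or.inl hv.2⟩, fun h' => Set.disjoint_left.1 hdisj hv.2 h'⟩
  refine hle.trans (measure_mono (inter_subset_inter_right _ ?_))
  rintro v (⟨a, b, ha, hb, rfl⟩ | ⟨a, b, ha, hb, rfl⟩)
  · exact ⟨a + b * s, b * t, by positivity, by positivity, by rw [hzdef]; module⟩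
  · exact ⟨a * s, a * t + b, by positivity, by positivity, by rw [hzdef]; module⟩

/-- The unit vector at which the unit circle is furthest from the chord joining two unit vectors,
with the functional parallel to that chord. -/
lemma exists_furthest_from_chord {x y : V} (hx : ‖x‖ = 1) (hy : ‖y‖ = 1) (h : wedge e x y ≠ 0) :
    ∃ (φ : V →L[ℝ] ℝ) (z : V) (s t : ℝ), ‖φ‖ = 1 ∧ ‖z‖ = 1 ∧ φ z = 1 ∧ 1 ≤ s + t ∧
      (s + t) * φ x = 1 ∧ (s + t) * φ y = 1 ∧ z = s • x + t • y ∧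
      (s = 1 ∧ t = 0 ∨ 1 < s + t ∧ 0 < s ∧ 0 < t) := by
  -- This functional is 1 on the chord, so its norm `s + t` measures how far the circle bulges
  -- beyond it. Norm 1 means that the chord is at maximal height, and then `z = x` serves.
  obtain ⟨φ, hφx, hφy⟩ := exists_functional e h 1 1
  have hφ0 : φ ≠ 0 := by rintro rfl; simp at hφx
  have hpos : 0 < ‖φ‖ := norm_pos_iff.2 hφ0
  have hone : 1 ≤ ‖φ‖ := by
    have := φ.le_opNorm x
    rw [hφx, hx] at this
    simpa using this
  have hunit : ‖‖φ‖⁻¹ • φ‖ = 1 := by rw [norm_smul]; simp [hpos.ne']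
  rcases hone.eq_or_lt with h1 | h1
  · refine ⟨φ, x, 1, 0, h1.symm, hx, hφx, by norm_num, by simp [hφx], by simp [hφy], by simp,
      Or.inl ⟨rfl, rfl⟩⟩
  · obtain ⟨z, hz, hφz⟩ := exists_norm_eq_one_apply_eq_norm hφ0
    have hzeq := eq_smul_add_of_wedge_ne_zero e h z
    set s := wedge e z y / wedge e x y
    set t := wedge e x z / wedge e x y
    have hst : s + t = ‖φ‖ := by
      rw [← hφz, hzeq]; simp [hφx, hφy]
    refine ⟨‖φ‖⁻¹ • φ, z, s, t, hunit, hz, ?_, ?_, ?_, ?_, hzeq, Or.inr ⟨?_, ?_⟩⟩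
    · simp [hφz, hpos.ne']
    · rw [hst]; exact hone
    · rw [hst]; simp [hφx, hpos.ne']
    · rw [hst]; simp [hφy, hpos.ne']
    · rw [hst]; exact h1
    · exact pos_of_one_lt_add hx hy (by rw [← hzeq, hz]) (by rw [hst]; exact h1)

/-- In `dualWedge_mul_wedge` for the vectors `x` and `y - x`, one product vanishes because `φ` is
constant on the chord, and `ψ` turns the other into the norm. -/
lemma norm_sub_eq_of_parallel {x y : V} {φ ψ : V →L[ℝ] ℝ} {h : ℝ} (hh : 0 ≤ h)
    (hφx : h * φ x = 1) (hφy : h * φ y = 1) (hψ : ψ (y - x) = ‖y - x‖) :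
    |dualWedge e φ ψ| * (h * |wedge e x y|) = ‖y - x‖ := by
  have h0 : h ≠ 0 := by rintro rfl; simp at hφx
  have h1 := dualWedge_mul_wedge e φ ψ x (y - x)
  have h2 : φ (y - x) = 0 := by
    rw [map_sub]
    exact (mul_eq_zero.1 (show h * (φ y - φ x) = 0 by linear_combination hφy - hφx)).resolve_left h0
  rw [h2, hψ, wedge_sub_right, wedge_self, sub_zero, zero_mul, sub_zero] at h1
  have h3 : dualWedge e φ ψ * (h * wedge e x y) = ‖y - x‖ := by
    linear_combination h * h1 + ‖y - x‖ * hφx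
  rw [← abs_of_nonneg (norm_nonneg (y - x)), ← h3, abs_mul, abs_mul, abs_of_nonneg hh]

lemma measure_sector_ge {x y : V} (hx : ‖x‖ = 1) (hy : ‖y‖ = 1) (h : wedge e x y ≠ 0) {s t : ℝ}
    (hz : ‖s • x + t • y‖ = 1) (hst : s = 1 ∧ t = 0 ∨ 1 < s + t ∧ 0 < s ∧ 0 < t) :
    ENNReal.ofReal ((s + t) * |wedge e x y| / 2) ≤
      e.addHaar (closedBall (0 : V) 1 ∩ openCone x y) := by
  have hX : Convex ℝ (closedBall (0 : V) 1) := convex_closedBall 0 1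
  rcases hst with ⟨rfl, rfl⟩ | ⟨-, hs, ht⟩
  · rw [add_zero, one_mul]
    exact Convex.measure_inter_openCone_ge e hX (by simp) h (by simp [hx]) (by simp [hy])
  · exact Convex.measure_inter_openCone_ge_of_mem e hX (by simp) h (by simp [hx]) (by simp [hy])
      hs ht (by simp [hz])

/-- The area of the sector spanned by a chord bounds the length of the chord. -/
lemma norm_sub_le_mul_measure_sector {x y : V} (hx : ‖x‖ = 1) (hy : ‖y‖ = 1)
    (h : wedge e x y ≠ 0) {κ : ℝ} (hκ : ∀ z : V, ‖z‖ = 1 → (z ∈ openCone x y ∨ z = x) →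
      ∀ φ ψ : V →L[ℝ] ℝ, ‖φ‖ ≤ 1 → ‖ψ‖ ≤ 1 → φ z = 1 → |dualWedge e φ ψ| ≤ κ) :
    ENNReal.ofReal ‖y - x‖ ≤
      ENNReal.ofReal (2 * κ) * e.addHaar (closedBall (0 : V) 1 ∩ openCone x y) := by
  obtain ⟨φ, z, s, t, hφ, hz, hφz, hone, hφx, hφy, rfl, hst⟩ := exists_furthest_from_chord e hx hy h
  obtain ⟨ψ, hψ, hψv⟩ := exists_supporting_functional (y - x)
  have h1 := norm_sub_eq_of_parallel e (by linarith) hφx hφy hψv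
  have h2 : |dualWedge e φ ψ| ≤ κ := by
    refine hκ _ hz ?_ φ ψ hφ.le hψ hφz
    rcases hst with ⟨rfl, rfl⟩ | ⟨-, hs, ht⟩
    · right; simp
    · left; exact ⟨s, t, hs, ht, rfl⟩
  refine le_trans ?_ (mul_le_mul_right (measure_sector_ge e hx hy h hz hst) _)
  have hκ0 : 0 ≤ κ := (abs_nonneg _).trans h2
  rw [← ENNReal.ofReal_mul (by positivity)]
  apply ENNReal.ofReal_le_ofReal
  rw [← h1]
  have : 0 ≤ (s + t) * |wedge e x y| := by positivity
  nlinarith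

end Cones

/-! ### Inscribed hexagons and the lower bound on the area -/

section Hexagon

variable {V : Type*} [NormedAddCommGroup V] [NormedSpace ℝ V]

/-- Two unit vectors whose difference is a unit vector: they are consecutive vertices of an affine
regular hexagon inscribed in the unit circle. -/
def IsHexagonPair (x y : V) : Prop := ‖x‖ = 1 ∧ ‖y‖ = 1 ∧ ‖y - x‖ = 1

lemma IsHexagonPair.rotate {x y : V} (h : IsHexagonPair x y) : IsHexagonPair y (y - x) :=
  ⟨h.2.1, h.2.2, by rw [sub_sub_cancel_left, norm_neg]; exact h.1⟩

/-- The hexagon with vertices `±x`, `±y`, `±(y - x)`. -/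
def hexagon (x y : V) : Set V := convexHull ℝ {x, y, y - x, -x, -y, -(y - x)}

lemma vertices_subset_hexagon (x y : V) :
    {x, y, y - x, -x, -y, -(y - x)} ⊆ hexagon x y := subset_convexHull ℝ _

lemma convex_hexagon (x y : V) : Convex ℝ (hexagon x y) := convex_convexHull ℝ _

lemma zero_mem_hexagon (x y : V) : (0 : V) ∈ hexagon x y := by
  have h1 : x ∈ hexagon x y := vertices_subset_hexagon x y (by simp)
  have h2 : -x ∈ hexagon x y := vertices_subset_hexagon x y (by simp)
  have := convex_hexagon x y h1 h2 (a := 1 / 2) (b := 1 / 2) (by norm_num) (by norm_num)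
    (by norm_num)
  simpa using this

lemma neg_mem_hexagon {x y v : V} (hv : v ∈ hexagon x y) : -v ∈ hexagon x y := by
  have hsub : hexagon x y ⊆ (fun v => -v) ⁻¹' hexagon x y := by
    refine convexHull_min ?_ ((convex_hexagon x y).is_linear_preimage IsLinearMap.isLinearMap_neg)
    intro v hv
    apply vertices_subset_hexagon x y
    simp only [mem_insert_iff, mem_singleton_iff] at hv ⊢
    rcases hv with rfl | rfl | rfl | rfl | rfl | rfl <;> simp
  exact hsub hv

lemma IsHexagonPair.hexagon_subset {x y : V} (h : IsHexagonPair x y) :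
    hexagon x y ⊆ closedBall 0 1 := by
  refine convexHull_min ?_ (convex_closedBall 0 1)
  intro v hv
  rw [mem_closedBall_zero_iff]
  simp only [mem_insert_iff, mem_singleton_iff] at hv
  obtain ⟨h1, h2, h3⟩ := h
  have h4 : ‖x - y‖ = 1 := by rw [norm_sub_rev, h3]
  rcases hv with rfl | rfl | rfl | rfl | rfl | rfl <;> simp [*]

lemma isClosed_hexagon (x y : V) : IsClosed (hexagon x y) :=
  Set.Finite.isClosed_convexHull (s := {x, y, y - x, -x, -y, -(y - x)}) ℝ (by simp)

variable (e : Module.Basis (Fin 2) ℝ V)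

lemma IsHexagonPair.wedge_ne_zero {x y : V} (h : IsHexagonPair x y) : wedge e x y ≠ 0 := by
  intro h0
  obtain ⟨hx, hy, hxy⟩ := h
  rcases eq_or_eq_neg_of_wedge_eq_zero e hx hy h0 with rfl | rfl
  · simp at hxy
  · rw [show -x - x = (-2 : ℝ) • x by module, norm_smul, hx] at hxy
    norm_num at hxy

lemma wedge_rotate (x y : V) : wedge e y (y - x) = wedge e x y := by
  rw [wedge_sub_right, wedge_self, wedge_swap e x y]; ring

/-- On the connected circle, `‖x + w‖` runs from 0 at `-w` to 2 at `w`, so it takes the value 1. -/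
lemma exists_isHexagonPair (e : Module.Basis (Fin 2) ℝ V) {w : V} (hw : ‖w‖ = 1) : ∃ x y : V, IsHexagonPair x y ∧ y - x = w := by
  have hrank : 1 < Module.rank ℝ V := by
    rw [rank_eq_card_basis e]; simp
  have hconn := isPreconnected_sphere hrank (0 : V) 1
  have h1 : (-w) ∈ sphere (0 : V) 1 := by simpa using hw
  have h2 : w ∈ sphere (0 : V) 1 := by simpa using hw
  have hcont : ContinuousOn (fun x : V => ‖x + w‖) (sphere 0 1) := by fun_prop
  have hiv := hconn.intermediate_value h1 h2 hcont
  have hmem : (1 : ℝ) ∈ Icc ‖-w + w‖ ‖w + w‖ := by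
    rw [← two_smul ℝ w, norm_smul, hw]
    simp
  obtain ⟨x, hx, hxw⟩ := hiv hmem
  exact ⟨x, x + w, ⟨by simpa using hx, hxw, by simpa using hw⟩, by simp⟩

variable [FiniteDimensional ℝ V] [MeasurableSpace V] [BorelSpace V]

lemma measure_inter_add_le {μ : Measure V} {A B C X : Set V} (hA : IsOpen A)
    (hdisj : ∀ v ∈ A, v ∉ B) (hAC : A ⊆ C) (hBC : B ⊆ C) :
    μ (X ∩ A) + μ (X ∩ B) ≤ μ (X ∩ C) := by
  rw [← measure_inter_add_sdiff (X ∩ C) hA.measurableSet]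
  exact add_le_add (measure_mono fun v hv => ⟨⟨hv.1, hAC hv.2⟩, hv.2⟩)
    (measure_mono fun v hv => ⟨⟨hv.1, hBC hv.2⟩, fun h => hdisj v h hv.2⟩)

/-- In coordinates along `x, y` the three cones are told apart by the signs of `S`, `T` and `S + T`.
All have `T > 0`, so their reflections are disjoint from them and contribute the same measure. -/
lemma measure_six_sectors_le {X : Set V} (hneg : ∀ v ∈ X, -v ∈ X) {x y : V}
    (h : wedge e x y ≠ 0) :
    2 * e.addHaar (X ∩ openCone x y) + 2 * e.addHaar (X ∩ openCone y (y - x)) +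
      2 * e.addHaar (X ∩ openCone (y - x) (-x)) ≤ e.addHaar X := by
  have h2 : wedge e y (y - x) ≠ 0 := by rwa [wedge_rotate]
  have h3 : wedge e (y - x) (-x) ≠ 0 := by
    have := wedge_rotate e y (y - x)
    rw [sub_sub_cancel_left] at this
    rwa [this]
  set S : V → ℝ := fun v => wedge e v y / wedge e x y with hS
  set T : V → ℝ := fun v => wedge e x v / wedge e x y with hT
  have hST : ∀ a b : ℝ, S (a • x + b • y) = a ∧ T (a • x + b • y) = b := by
    intro a b
    simp only [hS, hT, wedge_smul_add_smul_right, wedge_left_smul_add_smul,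
      mul_div_cancel_right₀ _ h, and_self]
  have hSneg : ∀ v, S (-v) = -S v := fun v => by simp only [hS, wedge_neg_left, neg_div]
  have hTneg : ∀ v, T (-v) = -T v := fun v => by simp only [hT, wedge_neg_right, neg_div]
  have c1 : ∀ v ∈ openCone x y, 0 < S v ∧ 0 < T v := by
    rintro v ⟨a, b, ha, hb, rfl⟩
    rw [(hST a b).1, (hST a b).2]; exact ⟨ha, hb⟩
  have c2 : ∀ v ∈ openCone y (y - x), S v < 0 ∧ 0 < S v + T v := by
    rintro v ⟨a, b, ha, hb, rfl⟩
    rw [show a • y + b • (y - x) = (-b) • x + (a + b) • y by module, (hST _ _).1, (hST _ _).2]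
    constructor <;> linarith
  have c3 : ∀ v ∈ openCone (y - x) (-x), 0 < T v ∧ S v + T v < 0 := by
    rintro v ⟨a, b, ha, hb, rfl⟩
    rw [show a • (y - x) + b • (-x) = (-a - b) • x + a • y by module, (hST _ _).1, (hST _ _).2]
    constructor <;> linarith
  set U : Set V := openCone x y ∪ openCone y (y - x) ∪ openCone (y - x) (-x) with hU
  have hUpos : ∀ v ∈ U, 0 < T v := by
    rintro v ((hv | hv) | hv)
    · exact (c1 v hv).2
    · linarith [(c2 v hv).1, (c2 v hv).2]
    · exact (c3 v hv).1
  have o1 := isOpen_openCone e h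
  have o2 := isOpen_openCone e h2
  have o3 := isOpen_openCone e h3
  have s1 : e.addHaar (X ∩ openCone x y) + e.addHaar (X ∩ openCone y (y - x)) ≤
      e.addHaar (X ∩ (openCone x y ∪ openCone y (y - x))) :=
    measure_inter_add_le o1 (fun v hv hv' => by linarith [(c1 v hv).1, (c2 v hv').1])
      subset_union_left subset_union_right
  have s2 : e.addHaar (X ∩ (openCone x y ∪ openCone y (y - x))) +
      e.addHaar (X ∩ openCone (y - x) (-x)) ≤ e.addHaar (X ∩ U) := by
    refine measure_inter_add_le (o1.union o2) ?_ subset_union_left subset_union_right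
    rintro v (hv | hv) hv'
    · linarith [(c1 v hv).1, (c1 v hv).2, (c3 v hv').2]
    · linarith [(c2 v hv).2, (c3 v hv').2]
  have s3 : e.addHaar (X ∩ U) + e.addHaar (X ∩ (-U)) ≤ e.addHaar (X ∩ univ) := by
    refine measure_inter_add_le ((o1.union o2).union o3) ?_ (subset_univ _) (subset_univ _)
    intro v hv hv'
    have h1 := hUpos v hv
    have h2 := hUpos (-v) hv'
    rw [hTneg] at h2
    linarith
  have s4 : e.addHaar (X ∩ (-U)) = e.addHaar (X ∩ U) := by
    rw [← Measure.measure_neg]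
    congr 1
    ext v
    simp only [Set.mem_neg, mem_inter_iff, neg_neg]
    exact ⟨fun h => ⟨by simpa using hneg _ h.1, h.2⟩, fun h => ⟨hneg _ h.1, h.2⟩⟩
  rw [s4, inter_univ, ← two_mul] at s3
  refine le_trans ?_ s3
  rw [← mul_add, ← mul_add]
  exact mul_le_mul_right ((add_le_add_left s1 _).trans s2) _

/-- A point of `A` off the closed set `C` is a limit of interior points of `A`, so `A \ C` would
contain a nonempty open set, which has positive measure. -/
lemma Convex.subset_of_measure_le {μ : Measure V} [μ.IsAddHaarMeasure] {A C : Set V}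
    (hA : Convex ℝ A) (hint : (interior A).Nonempty) (hC : IsClosed C) (hfin : μ A ≠ ⊤)
    (hle : μ A ≤ μ (A ∩ C)) : A ⊆ C := by
  have hzero : μ (A \ C) = 0 := by
    have h1 := measure_inter_add_sdiff A hC.measurableSet (μ := μ)
    have h2 : μ (A ∩ C) ≠ ⊤ := ne_top_of_le_ne_top hfin (measure_mono inter_subset_left)
    have h3 : μ (A ∩ C) + μ (A \ C) ≤ μ (A ∩ C) + 0 := by rw [h1, add_zero]; exact hle
    exact le_antisymm ((ENNReal.add_le_add_iff_left h2).1 h3) zero_le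
  intro a ha
  by_contra haC
  have hcl : a ∈ closure (interior A) := by
    rw [hA.closure_interior_eq_closure_of_nonempty_interior hint]; exact subset_closure ha
  obtain ⟨v, hvC, hvA⟩ := mem_closure_iff.1 hcl Cᶜ hC.isOpen_compl haC
  have hpos := (hC.isOpen_compl.inter isOpen_interior).measure_pos μ ⟨v, hvC, hvA⟩
  refine hpos.ne' (measure_mono_null ?_ hzero)
  exact fun w hw => ⟨interior_subset hw.2, hw.1⟩

variable {e}

lemma IsExtremal.one_le_two_mul_sector (he : IsExtremal e) {x y : V} (h : IsHexagonPair x y) :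
    1 ≤ 2 * e.addHaar (closedBall (0 : V) 1 ∩ openCone x y) := by
  have := norm_sub_le_mul_measure_sector e h.1 h.2.1 (h.wedge_ne_zero e) (κ := 1)
    (fun z _ _ φ ψ hφ hψ _ => (he.abs_dualWedge_le φ ψ).trans
      (mul_le_one₀ hφ (norm_nonneg _) hψ))
  rw [h.2.2] at this
  simpa using this

lemma neg_mem_closedBall_one {v : V} (hv : v ∈ closedBall (0 : V) 1) :
    -v ∈ closedBall (0 : V) 1 := by simpa using hv

lemma exists_norm_eq_one (e : Module.Basis (Fin 2) ℝ V) : ∃ w : V, ‖w‖ = 1 := by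
  have h0 : ‖e 0‖ ≠ 0 := norm_ne_zero_iff.2 (e.ne_zero 0)
  exact ⟨‖e 0‖⁻¹ • e 0, by rw [norm_smul]; simp [h0]⟩

theorem IsExtremal.three_le_measure_closedBall (he : IsExtremal e) :
    3 ≤ e.addHaar (closedBall (0 : V) 1) := by
  obtain ⟨w, hw⟩ := exists_norm_eq_one e
  obtain ⟨x, y, h, -⟩ := exists_isHexagonPair e hw
  have h3 := h.rotate.rotate
  rw [sub_sub_cancel_left] at h3
  refine le_trans ?_ (measure_six_sectors_le e (fun v => neg_mem_closedBall_one)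
    (h.wedge_ne_zero e))
  calc (3 : ENNReal) = 1 + 1 + 1 := by norm_num
    _ ≤ _ := add_le_add (add_le_add (he.one_le_two_mul_sector h)
      (he.one_le_two_mul_sector h.rotate)) (he.one_le_two_mul_sector h3)

/-- The other two pairs of opposite sectors already account for 2 of the total area 3. -/
lemma IsExtremal.two_mul_sector_le_one (he : IsExtremal e)
    (h3 : e.addHaar (closedBall (0 : V) 1) = 3) {x y : V} (h : IsHexagonPair x y) :
    2 * e.addHaar (closedBall (0 : V) 1 ∩ openCone x y) ≤ 1 := by
  have hr := h.rotate.rotate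
  rw [sub_sub_cancel_left] at hr
  have h1 := measure_six_sectors_le e (fun v => neg_mem_closedBall_one) (h.wedge_ne_zero e)
  rw [h3] at h1
  have h2 : 2 * e.addHaar (closedBall (0 : V) 1 ∩ openCone x y) + 2 ≤ 1 + 2 := by
    calc _ = 2 * e.addHaar (closedBall (0 : V) 1 ∩ openCone x y) + 1 + 1 := by
          rw [add_assoc]; norm_num
      _ ≤ _ := add_le_add (add_le_add_right (he.one_le_two_mul_sector h.rotate) _)
          (he.one_le_two_mul_sector hr)
      _ ≤ 3 := h1
      _ = 1 + 2 := by norm_num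
  exact (ENNReal.add_le_add_iff_right ENNReal.ofNat_ne_top).1 h2

lemma norm_le_one_of_forall_apply_le {χ : V →L[ℝ] ℝ} (h : ∀ b : V, ‖b‖ ≤ 1 → χ b ≤ 1) :
    ‖χ‖ ≤ 1 := by
  refine ContinuousLinearMap.opNorm_le_of_unit_norm zero_le_one fun z hz => ?_
  have h1 := h z hz.le
  have h2 := h (-z) (by rw [norm_neg]; exact hz.le)
  rw [map_neg] at h2
  rw [Real.norm_eq_abs, abs_le]
  constructor <;> linarith

/-- If the unit disc has the minimal possible area, then either the triangle spanned by a hexagon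
pair has maximal area, or the arc between its vertices has a corner. -/
lemma IsExtremal.wedge_eq_one_or_exists_corner (he : IsExtremal e)
    (h3 : e.addHaar (closedBall (0 : V) 1) = 3) {x y : V} (h : IsHexagonPair x y) :
    |wedge e x y| = 1 ∨ ∃ (z : V) (φ : V →L[ℝ] ℝ) (r : ℝ), ‖z‖ = 1 ∧ φ z = 1 ∧ 0 < r ∧
      ‖φ + r • wedgeLeft e z‖ ≤ 1 ∧ ‖φ + (-r) • wedgeLeft e z‖ ≤ 1 ∧
      ∀ ψ : V →L[ℝ] ℝ, ‖ψ‖ ≤ 1 → ψ (y - x) = 1 → ψ z = 0 := by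
  have hw := h.wedge_ne_zero e
  obtain ⟨hx, hy, hxy⟩ := h
  obtain ⟨φ, z, s, t, hφ, hz, hφz, hone, hφx, hφy, hzst, hst⟩ := exists_furthest_from_chord e hx hy hw
  set k := s + t with hk
  have hsec := he.two_mul_sector_le_one h3 ⟨hx, hy, hxy⟩
  have hpar : ∀ ψ : V →L[ℝ] ℝ, ψ (y - x) = 1 → |dualWedge e φ ψ| * (k * |wedge e x y|) = 1 := by
    intro ψ hψ
    rw [norm_sub_eq_of_parallel e (by linarith) hφx hφy (by rw [hψ, hxy]), hxy]
  have hkw : k * |wedge e x y| = 1 := by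
    apply le_antisymm
    · have h1 := (mul_le_mul_right (measure_sector_ge e hx hy hw (by rw [← hzst, hz]) hst) 2).trans hsec
      rw [show (2 : ENNReal) = ENNReal.ofReal 2 by norm_num, ← ENNReal.ofReal_mul (by norm_num),
        ← ENNReal.ofReal_one, ENNReal.ofReal_le_ofReal_iff zero_le_one] at h1
      linarith
    · obtain ⟨ψ, hψ, hψv⟩ := exists_supporting_functional (y - x)
      have h1 := hpar ψ (by rw [hψv, hxy])
      have h2 : |dualWedge e φ ψ| ≤ 1 :=
        (he.abs_dualWedge_le φ ψ).trans (mul_le_one₀ hφ.le (norm_nonneg _) hψ)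
      have h4 : 0 ≤ k * |wedge e x y| := mul_nonneg (by linarith) (abs_nonneg _)
      nlinarith
  rcases hst with ⟨rfl, rfl⟩ | ⟨hk1, hs, ht⟩
  · left
    rw [hk] at hkw
    simpa using hkw
  right
  have hk0 : 0 < k := by linarith
  set C := convexHull ℝ {0, x, z, y} with hC
  have hCsub : ∀ v ∈ ({0, x, z, y} : Set V), v ∈ C := fun v hv => subset_convexHull ℝ _ hv
  have hCclosed : IsClosed C := Set.Finite.isClosed_convexHull (s := {0, x, z, y}) ℝ (by simp)
  have hCball : C ⊆ closedBall 0 1 := by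
    refine convexHull_min ?_ (convex_closedBall 0 1)
    intro v hv
    simp only [mem_insert_iff, mem_singleton_iff] at hv
    rw [mem_closedBall_zero_iff]
    rcases hv with rfl | rfl | rfl | rfl
    · simp
    · exact hx.le
    · exact hz.le
    · exact hy.le
  -- The quadrilateral `0xzy` alone has area `k |x ∧ y| / 2 = 1/2`, which is all the area the sector
  -- may have.
  have hcover : closedBall (0 : V) 1 ∩ openCone x y ⊆ C := by
    refine Convex.subset_of_measure_le (μ := e.addHaar) ?_ ?_ hCclosed ?_ ?_
    · refine (convex_closedBall 0 1).inter ?_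
      rintro v ⟨a, b, ha, hb, rfl⟩ v' ⟨a', b', ha', hb', rfl⟩ p q hp hq hpq
      have hpq' : 0 < p ∨ 0 < q := by
        by_contra! hcon; linarith
      refine ⟨p * a + q * a', p * b + q * b', ?_, ?_, by module⟩
      · rcases hpq' with h0 | h0 <;> positivity
      · rcases hpq' with h0 | h0 <;> positivity
    · refine ⟨(1 / 3 : ℝ) • x + (1 / 3 : ℝ) • y, mem_interior.2 ⟨openTriangle x y, ?_,
        isOpen_openTriangle e hw, 1 / 3, 1 / 3, by norm_num, by norm_num, by norm_num, rfl⟩⟩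
      exact subset_inter ((openTriangle_subset_triangle x y).trans
        (Convex.triangle_subset (convex_closedBall 0 1) (by simp) (by simp [hx]) (by simp [hy])))
        (openTriangle_subset_openCone x y)
    · exact ne_top_of_le_ne_top (by rw [h3]; exact ENNReal.ofNat_ne_top)
        (measure_mono inter_subset_left)
    · have h1 := Convex.measure_inter_openCone_ge_of_mem e (convex_convexHull ℝ {0, x, z, y})
        (hCsub 0 (by simp)) hw (hCsub x (by simp)) (hCsub y (by simp)) hs ht
        (by rw [← hzst]; exact hCsub z (by simp))
      rw [← hk, hkw] at h1
      have h2 : e.addHaar (closedBall (0 : V) 1 ∩ openCone x y) ≤ ENNReal.ofReal (1 / 2) := by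
        rw [ENNReal.ofReal_div_of_pos two_pos, ENNReal.le_div_iff_mul_le (by simp) (by simp), mul_comm]
        simpa using hsec
      exact h2.trans (h1.trans (measure_mono fun v hv => ⟨⟨hCball hv.1, hv.2⟩, hv.1⟩))
  set η := wedgeLeft e z with hη
  have hkinv : k⁻¹ < 1 := inv_lt_one_of_one_lt₀ hk1
  -- The tilt is small enough that at points no higher than the chord, where `φ ≤ k⁻¹`, the tilted
  -- functional stays at most 1.
  obtain ⟨r, hr, hrη⟩ : ∃ r : ℝ, 0 < r ∧ r * ‖η‖ ≤ 1 - k⁻¹ := by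
    refine ⟨(1 - k⁻¹) / (‖η‖ + 1), by have := norm_nonneg η; apply div_pos <;> linarith, ?_⟩
    rw [div_mul_eq_mul_div, div_le_iff₀ (by positivity)]
    have := norm_nonneg η
    nlinarith
  have hφx' : φ x = k⁻¹ := eq_inv_of_mul_eq_one_right hφx
  have hφy' : φ y = k⁻¹ := eq_inv_of_mul_eq_one_right hφy
  have hχ : ∀ q : ℝ, |q| ≤ r → ‖φ + q • η‖ ≤ 1 := by
    intro q hq
    have hηle : ∀ b : V, ‖b‖ ≤ 1 → q * η b ≤ 1 - k⁻¹ := by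
      intro b hb
      have h1 : |η b| ≤ ‖η‖ := by
        have := η.le_opNorm b
        rw [Real.norm_eq_abs] at this
        nlinarith [norm_nonneg η]
      have h2 : q * η b ≤ |q| * |η b| := by rw [← abs_mul]; exact le_abs_self _
      have h4 : |q| * |η b| ≤ r * ‖η‖ := mul_le_mul hq h1 (abs_nonneg _) hr.le
      linarith
    apply norm_le_one_of_forall_apply_le
    intro b hb
    -- Above the chord the disc lies in the quadrilateral, so only its vertices need checking; at
    -- `z` the tilt vanishes.
    by_cases hφb : φ b ≤ k⁻¹
    · have := hηle b hb
      simp only [add_apply, smul_apply, smul_eq_mul]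
      linarith
    · push Not at hφb
      have hbeq := eq_smul_add_of_wedge_ne_zero e hw b
      set a' := wedge e b y / wedge e x y
      set b' := wedge e x b / wedge e x y
      have h1 : φ b = (a' + b') * k⁻¹ := by
        rw [hbeq]; simp only [map_add, map_smul, smul_eq_mul, hφx', hφy']; ring
      have h2 : 1 < a' + b' := by
        rw [h1] at hφb
        have := inv_pos.2 hk0
        by_contra! hcon
        nlinarith
      have h4 := pos_of_one_lt_add hx hy (by rw [← hbeq]; exact hb) h2
      have h5 : b ∈ C := hcover ⟨by simpa using hb, a', b', h4.1, h4.2, hbeq⟩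
      have h6 : C ⊆ {v | (φ + q • η) v ≤ 1} := by
        refine convexHull_min ?_ ?_
        · intro v hv
          simp only [mem_insert_iff, mem_singleton_iff] at hv
          simp only [mem_ofPred_eq, add_apply, smul_apply, smul_eq_mul]
          rcases hv with rfl | rfl | rfl | rfl
          · simp
          · linarith [hηle _ hx.le]
          · rw [hφz, hη, wedgeLeft_apply, wedge_self]; simp
          · linarith [hηle _ hy.le]
        · exact convex_halfSpace_le (φ + q • η).isLinear 1
      exact h6 h5
  refine ⟨z, φ, r, hz, hφz, hr, hχ r (abs_of_pos hr).le,
    hχ (-r) (by rw [abs_neg]; exact (abs_of_pos hr).le), ?_⟩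
  intro ψ hψ hψv
  have h1 := hpar ψ hψv
  rw [hkw, mul_one] at h1
  -- The determinant is affine in the tilt `q`, has modulus 1 at `q = 0`, and has modulus at most 1
  -- on both sides; hence its slope `-ψ z` is zero.
  have hb : ∀ q : ℝ, |q| ≤ r → |dualWedge e φ ψ + q * (-ψ z)| ≤ 1 := by
    intro q hq
    rw [← dualWedge_wedgeLeft e z ψ, ← dualWedge_smul_left, ← dualWedge_add_left]
    exact (he.abs_dualWedge_le _ _).trans (mul_le_one₀ (hχ q hq) (norm_nonneg _) hψ)
  have hb1 := abs_le.1 (hb r (abs_of_pos hr).le)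
  have hb2 := abs_le.1 (hb (-r) (by rw [abs_neg]; exact (abs_of_pos hr).le))
  have hzero : r * ψ z = 0 := by
    rcases (abs_eq zero_le_one).1 h1 with h2 | h2 <;> rw [h2] at hb1 hb2 <;> linarith
  exact (mul_eq_zero.1 hzero).resolve_left hr.ne'

/-- Suppose both the first hexagon and one with a side vector equal to its corner `z` have corners,
`z` and `z'`. The tilted functionals at `z` all norm that side, so they vanish at `z'`. Thus `φ z' =
0` and `z'` is parallel to `z`, contradicting `φ z = 1`. -/
lemma IsExtremal.exists_wedge_eq_one (he : IsExtremal e)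
    (h3 : e.addHaar (closedBall (0 : V) 1) = 3) :
    ∃ x y : V, IsHexagonPair x y ∧ |wedge e x y| = 1 := by
  obtain ⟨w, hw⟩ := exists_norm_eq_one e
  obtain ⟨x, y, h, -⟩ := exists_isHexagonPair e hw
  rcases he.wedge_eq_one_or_exists_corner h3 h with h1 | ⟨z, φ, r, hz, hφz, hr, hp, hm, -⟩
  · exact ⟨x, y, h, h1⟩
  obtain ⟨x', y', h', rfl⟩ := exists_isHexagonPair e hz
  rcases he.wedge_eq_one_or_exists_corner h3 h' with h1 | ⟨z', -, -, hz', -, -, -, -, hψ⟩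
  · exact ⟨x', y', h', h1⟩
  exfalso
  have h1 := hψ _ hp (by simp [hφz, wedge_self])
  have h2 := hψ _ hm (by simp [hφz, wedge_self])
  simp only [add_apply, smul_apply, smul_eq_mul, wedgeLeft_apply] at h1 h2
  have h4 : wedge e (y' - x') z' = 0 := by
    have : r * wedge e (y' - x') z' = 0 := by linarith
    exact (mul_eq_zero.1 this).resolve_left hr.ne'
  have h5 : φ z' = 0 := by linarith
  rcases eq_or_eq_neg_of_wedge_eq_zero e hz hz' h4 with h6 | h6
  · rw [h6, hφz] at h5; norm_num at h5
  · rw [h6, map_neg, hφz] at h5; norm_num at h5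

lemma le_measure_hexagon (e : Module.Basis (Fin 2) ℝ V) {x y : V} (h : wedge e x y ≠ 0) :
    ENNReal.ofReal (3 * |wedge e x y|) ≤ e.addHaar (hexagon x y) := by
  have h2 : wedge e y (y - x) = wedge e x y := wedge_rotate e x y
  have h3 : wedge e (y - x) (-x) = wedge e x y := by
    have := wedge_rotate e y (y - x)
    rw [sub_sub_cancel_left] at this
    rw [this, h2]
  refine le_trans ?_ (measure_six_sectors_le e (fun v => neg_mem_hexagon) h)
  have hX := convex_hexagon x y
  have h0 := zero_mem_hexagon x y
  have hv := vertices_subset_hexagon x y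
  have b1 := Convex.measure_inter_openCone_ge e hX h0 h (hv (by simp)) (hv (by simp))
  have b2 := Convex.measure_inter_openCone_ge e hX h0 (by rwa [h2] : wedge e y (y - x) ≠ 0)
    (hv (by simp)) (hv (by simp))
  have b3 := Convex.measure_inter_openCone_ge e hX h0 (by rwa [h3] : wedge e (y - x) (-x) ≠ 0)
    (hv (by simp)) (hv (by simp))
  rw [h2] at b2
  rw [h3] at b3
  rw [← mul_add, ← mul_add]
  refine le_trans ?_ (mul_le_mul_right (add_le_add (add_le_add b1 b2) b3) 2)
  rw [← ENNReal.ofReal_add (by positivity) (by positivity),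
    ← ENNReal.ofReal_add (by positivity) (by positivity),
    show (2 : ENNReal) = ENNReal.ofReal 2 by norm_num, ← ENNReal.ofReal_mul (by norm_num)]
  apply ENNReal.ofReal_le_ofReal
  linarith

lemma IsExtremal.exists_closedBall_eq_hexagon (he : IsExtremal e)
    (h3 : e.addHaar (closedBall (0 : V) 1) = 3) :
    ∃ x y : V, wedge e x y ≠ 0 ∧ closedBall (0 : V) 1 = hexagon x y := by
  obtain ⟨x, y, h, h1⟩ := he.exists_wedge_eq_one h3
  have hw := h.wedge_ne_zero e
  refine ⟨x, y, hw, Subset.antisymm ?_ h.hexagon_subset⟩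
  refine Convex.subset_of_measure_le (μ := e.addHaar) (convex_closedBall 0 1) ?_
    (isClosed_hexagon x y) (by rw [h3]; exact ENNReal.ofNat_ne_top) ?_
  · exact ⟨0, ball_subset_interior_closedBall (by simp)⟩
  · rw [inter_eq_self_of_subset_right h.hexagon_subset, h3]
    have := le_measure_hexagon e hw
    rw [h1] at this
    simpa using this

/-- The coordinates along `x, y` and their sum are bounded by 1 on the hexagon, since they are at
the vertices. Splitting by signs then covers the hexagon by three closed triangles and their
reflections. -/
lemma measure_hexagon_le (e : Module.Basis (Fin 2) ℝ V) {x y : V} (h : wedge e x y ≠ 0) :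
    e.addHaar (hexagon x y) ≤ ENNReal.ofReal (3 * |wedge e x y|) := by
  have h2 : wedge e y (y - x) = wedge e x y := wedge_rotate e x y
  have h3 : wedge e (y - x) (-x) = wedge e x y := by
    have := wedge_rotate e y (y - x)
    rw [sub_sub_cancel_left] at this
    rw [this, h2]
  set U := triangle x y ∪ triangle y (y - x) ∪ triangle (y - x) (-x) with hU
  have hUle : e.addHaar U ≤ ENNReal.ofReal (3 * |wedge e x y| / 2) := by
    refine (measure_union_le _ _).trans ((add_le_add_left (measure_union_le _ _) _).trans ?_)
    rw [(measure_triangles e h).2, (measure_triangles e (by rwa [h2])).2,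
      (measure_triangles e (by rwa [h3])).2, h2, h3,
      ← ENNReal.ofReal_add (by positivity) (by positivity),
      ← ENNReal.ofReal_add (by positivity) (by positivity)]
    apply ENNReal.ofReal_le_ofReal
    linarith
  have hbound : ∀ v ∈ hexagon x y, |wedge e v y / wedge e x y| ≤ 1 ∧
      |wedge e x v / wedge e x y| ≤ 1 ∧
      |wedge e v y / wedge e x y + wedge e x v / wedge e x y| ≤ 1 := by
    have hfun : ∀ χ : V →L[ℝ] ℝ, |χ x| ≤ 1 → |χ y| ≤ 1 → |χ y - χ x| ≤ 1 →
        ∀ v ∈ hexagon x y, |χ v| ≤ 1 := by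
      intro χ h1 h2 h4
      have hsub : hexagon x y ⊆ {v | χ v ≤ 1} ∩ {v | -1 ≤ χ v} := by
        refine convexHull_min ?_
          ((convex_halfSpace_le χ.isLinear 1).inter (convex_halfSpace_ge χ.isLinear (-1)))
        intro v hv
        simp only [mem_insert_iff, mem_singleton_iff] at hv
        rw [abs_le] at h1 h2 h4
        rcases hv with rfl | rfl | rfl | rfl | rfl | rfl <;> constructor <;>
          simp only [mem_ofPred_eq, map_neg, map_sub] <;> linarith
      intro v hv
      exact abs_le.2 ⟨(hsub hv).2, (hsub hv).1⟩
    have e1 : ∀ v, (-(wedge e x y)⁻¹ • wedgeLeft e y) v = wedge e v y / wedge e x y := by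
      intro v
      simp only [smul_apply, smul_eq_mul, wedgeLeft_apply, wedge_swap e v y]
      ring
    have e2 : ∀ v, ((wedge e x y)⁻¹ • wedgeLeft e x) v = wedge e x v / wedge e x y := by
      intro v
      simp only [smul_apply, smul_eq_mul, wedgeLeft_apply]
      ring
    intro v hv
    refine ⟨?_, ?_, ?_⟩
    · rw [← e1]
      apply hfun _ _ _ _ v hv <;> simp only [e1, wedge_self, div_self h] <;> simp
    · rw [← e2]
      apply hfun _ _ _ _ v hv <;> simp only [e2, wedge_self, div_self h] <;> simp
    · rw [← e1, ← e2, ← add_apply]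
      apply hfun _ _ _ _ v hv <;> simp only [add_apply, e1, e2, wedge_self, div_self h] <;> simp
  have hcover : hexagon x y ⊆ U ∪ -U := by
    intro v hv
    obtain ⟨b1, b2, b3⟩ := hbound v hv
    have hveq := eq_smul_add_of_wedge_ne_zero e h v
    set s := wedge e v y / wedge e x y
    set t := wedge e x v / wedge e x y
    rw [abs_le] at b1 b2 b3
    have key : ∀ s t : ℝ, |s| ≤ 1 → |t| ≤ 1 → |s + t| ≤ 1 → 0 ≤ t → s • x + t • y ∈ U := by
      intro s t c1 c2 c3 ht
      rw [abs_le] at c1 c2 c3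
      by_cases hs : 0 ≤ s
      · left; left; exact ⟨s, t, hs, ht, c3.2, rfl⟩
      push Not at hs
      by_cases hst : 0 ≤ s + t
      · left; right; exact ⟨s + t, -s, hst, by linarith, by linarith, by module⟩
      · right; exact ⟨t, -(s + t), ht, by linarith, by linarith, by module⟩
    by_cases ht : 0 ≤ t
    · left; rw [hveq]; exact key s t (abs_le.2 b1) (abs_le.2 b2) (abs_le.2 b3) ht
    · right
      rw [Set.mem_neg, hveq, show -(s • x + t • y) = (-s) • x + (-t) • y by module]
      apply key
      · rw [abs_neg]; exact abs_le.2 b1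
      · rw [abs_neg]; exact abs_le.2 b2
      · rw [← neg_add, abs_neg]; exact abs_le.2 b3
      · linarith
  refine (measure_mono hcover).trans ((measure_union_le _ _).trans ?_)
  rw [Measure.measure_neg]
  refine (add_le_add hUle hUle).trans ?_
  rw [← ENNReal.ofReal_add (by positivity) (by positivity)]
  apply ENNReal.ofReal_le_ofReal
  linarith

/-- Among `|a|`, `|b|`, `|b - a|` the largest is the sum of the other two, so those two sum to at
most 1. The determinant can be expanded along that pair with coefficients taken, up to sign, from
`c`, `d`, `d - c`. -/
lemma abs_det_le_one {a b c d : ℝ} (ha : |a| ≤ 1) (hb : |b| ≤ 1) (hab : |b - a| ≤ 1)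
    (hc : |c| ≤ 1) (hd : |d| ≤ 1) (hcd : |d - c| ≤ 1) : |a * d - b * c| ≤ 1 := by
  have key : ∀ p q u v : ℝ, |u| ≤ 1 → |v| ≤ 1 → |p| + |q| ≤ 1 → |p * u + q * v| ≤ 1 := by
    intro p q u v hu hv hpq
    have h1 := abs_add_le (p * u) (q * v)
    rw [abs_mul, abs_mul] at h1
    nlinarith [abs_nonneg p, abs_nonneg q]
  have hc' : |-c| ≤ 1 := by rwa [abs_neg]
  have hcd' : |c - d| ≤ 1 := by rwa [abs_sub_comm]
  have hsum : |a| + |b| ≤ 1 ∨ |a| + |b - a| ≤ 1 ∨ |b| + |b - a| ≤ 1 := by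
    rw [abs_le] at ha hb hab
    rcases abs_cases a with h1 | h1 <;> rcases abs_cases b with h2 | h2 <;>
      rcases abs_cases (b - a) with h3 | h3 <;> rw [h1.1, h2.1, h3.1] <;>
      first
      | (left; linarith)
      | (right; left; linarith)
      | (right; right; linarith)
  rcases hsum with h | h | h
  · rw [show a * d - b * c = a * d + b * (-c) by ring]
    exact key _ _ _ _ hd hc' h
  · rw [show a * d - b * c = a * (d - c) + (b - a) * (-c) by ring]
    exact key _ _ _ _ hcd hc' h
  · rw [show a * d - b * c = b * (d - c) + (b - a) * (-d) by ring]
    exact key _ _ _ _ hcd (by rwa [abs_neg]) h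

lemma IsExtremal.measure_closedBall_le (he : IsExtremal e) {x y : V} (h : wedge e x y ≠ 0)
    (hxy : closedBall (0 : V) 1 = hexagon x y) : e.addHaar (closedBall (0 : V) 1) ≤ 3 := by
  have hn : ∀ v ∈ ({x, y, y - x, -x, -y, -(y - x)} : Set V), ∀ i, |e.repr v i| ≤ 1 := by
    intro v hv i
    have h1 : v ∈ closedBall (0 : V) 1 := hxy ▸ vertices_subset_hexagon x y hv
    exact (he.abs_repr_le v i).trans (by simpa using h1)
  have h1 : |wedge e x y| ≤ 1 := by
    have hd := hn (y - x) (by simp)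
    simp only [map_sub, Finsupp.sub_apply] at hd
    have := abs_det_le_one (hn x (by simp) 0) (hn y (by simp) 0) (hd 0) (hn x (by simp) 1)
      (hn y (by simp) 1) (hd 1)
    rw [wedge]
    convert this using 2
    ring
  rw [hxy]
  refine (measure_hexagon_le e h).trans ?_
  rw [show (3 : ENNReal) = ENNReal.ofReal 3 by norm_num]
  exact ENNReal.ofReal_le_ofReal (by linarith)

end Hexagon

/-! ### Hexagonal discs and affine regular hexagons -/

section AffineRegular

lemma setOf_pow_six_eq_one {ζ : ℂ} (hζ : ζ ^ 2 = ζ - 1) :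
    {z : ℂ | z ^ 6 = 1} = {1, ζ, ζ - 1, -1, -ζ, -(ζ - 1)} := by
  ext z
  have hfac : z ^ 6 - 1 =
      (z - 1) * (z - ζ) * (z - (ζ - 1)) * (z - (-1)) * (z - (-ζ)) * (z - (-(ζ - 1))) := by
    have h4 : ζ ^ 4 = -ζ := by linear_combination (ζ ^ 2 + ζ) * hζ
    have h3 : ζ ^ 3 = -1 := by linear_combination (ζ + 1) * hζ
    ring_nf
    simp only [h4, h3, hζ]
    ring
  simp only [mem_ofPred_eq, mem_insert_iff, mem_singleton_iff]
  rw [← sub_eq_zero, hfac]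
  simp only [mul_eq_zero, sub_eq_zero, or_assoc]

/-- The primitive sixth root of unity in the upper half plane. -/
noncomputable def sixthRoot : ℂ := ⟨1 / 2, √3 / 2⟩

lemma sixthRoot_sq : sixthRoot ^ 2 = sixthRoot - 1 := by
  have h3 : √3 * √3 = 3 := Real.mul_self_sqrt (by norm_num)
  apply Complex.ext
  · simp [sixthRoot, pow_two]; linarith
  · simp [sixthRoot, pow_two]; ring

lemma convexHull_pow_six_eq_one : convexHull ℝ {z : ℂ | z ^ 6 = 1} = hexagon 1 sixthRoot := by
  rw [setOf_pow_six_eq_one sixthRoot_sq]; rfl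

variable {V : Type*} [NormedAddCommGroup V] [NormedSpace ℝ V]

lemma image_hexagon {W : Type*} [NormedAddCommGroup W] [NormedSpace ℝ W] (f : W →ₗ[ℝ] V)
    (x y : W) : f '' hexagon x y = hexagon (f x) (f y) := by
  unfold hexagon
  rw [f.image_convexHull]
  simp only [image_insert_eq, image_singleton, map_sub, map_neg]

variable (e : Module.Basis (Fin 2) ℝ V) [FiniteDimensional ℝ V]

lemma image_frontier_linearEquiv (f : ℂ ≃ₗ[ℝ] V) (K : Set ℂ) :
    f '' frontier K = frontier (f '' K) :=
  f.toContinuousLinearEquiv.toHomeomorph.image_frontier K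

lemma isAffineRegularHexagon_of_eq_hexagon {x y : V} (h : wedge e x y ≠ 0)
    (hxy : closedBall (0 : V) 1 = hexagon x y) : IsAffineRegularHexagon (sphere (0 : V) 1) := by
  have h3 : √3 ≠ 0 := by positivity
  -- The second vector is the image of `Complex.I`: it is chosen so that `1 ↦ x` extends linearly
  -- with `sixthRoot ↦ y`.
  have hli : LinearIndependent ℝ ![x, (2 / √3) • (y - (1 / 2 : ℝ) • x)] := by
    apply linearIndependent_pair_of_wedge_ne_zero e
    rw [wedge_smul_right, wedge_sub_right, wedge_smul_right, wedge_self, mul_zero, sub_zero]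
    positivity
  have hcard : Fintype.card (Fin 2) = Module.finrank ℝ V := by
    rw [Module.finrank_eq_card_basis e]
  let b := basisOfLinearIndependentOfCardEqFinrank hli hcard
  let f : ℂ ≃ₗ[ℝ] V := Complex.basisOneI.equiv b (Equiv.refl _)
  have hf1 : f 1 = x := by
    have := Complex.basisOneI.equiv_apply 0 b (Equiv.refl _)
    simpa [f, b] using this
  have hfI : f Complex.I = (2 / √3) • (y - (1 / 2 : ℝ) • x) := by
    have := Complex.basisOneI.equiv_apply 1 b (Equiv.refl _)
    simpa [f, b] using this
  have hfζ : f sixthRoot = y := by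
    have : sixthRoot = (1 / 2 : ℝ) • (1 : ℂ) + (√3 / 2) • Complex.I := by
      apply Complex.ext <;> simp [sixthRoot]
    rw [this, map_add, map_smul, map_smul, hf1, hfI, smul_smul,
      show √3 / 2 * (2 / √3) = 1 by field_simp]
    module
  refine ⟨f.toAffineEquiv, ?_⟩
  rw [← frontier_closedBall (0 : V) one_ne_zero, hxy, convexHull_pow_six_eq_one]
  change _ = f '' _
  rw [image_frontier_linearEquiv]
  congr 1
  have := image_hexagon f.toLinearMap 1 sixthRoot
  simp only [LinearEquiv.coe_coe, hf1, hfζ] at this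
  exact this.symm

/-- The hull lies in the unit disc, so its interior lies in the open disc, which contains no sixth
root of unity. -/
lemma pow_six_eq_one_subset_frontier :
    {z : ℂ | z ^ 6 = 1} ⊆ frontier (convexHull ℝ {z : ℂ | z ^ 6 = 1}) := by
  have hnorm : ∀ z ∈ {z : ℂ | z ^ 6 = 1}, ‖z‖ = 1 := by
    intro z hz
    have h1 : ‖z‖ ^ 6 = 1 := by rw [← norm_pow, hz, norm_one]
    exact (pow_eq_one_iff_of_nonneg (norm_nonneg z) (by norm_num)).1 h1
  have hsub : convexHull ℝ {z : ℂ | z ^ 6 = 1} ⊆ closedBall 0 1 :=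
    convexHull_min (fun z hz => by simpa using (hnorm z hz).le) (convex_closedBall 0 1)
  intro z hz
  refine ⟨subset_closure (subset_convexHull ℝ _ hz), fun hint => ?_⟩
  have h1 := interior_mono hsub hint
  rw [interior_closedBall _ one_ne_zero, mem_ball_zero_iff, hnorm z hz] at h1
  exact lt_irrefl _ h1

lemma exists_closedBall_eq_hexagon_of_isAffineRegularHexagon
    (h : IsAffineRegularHexagon (sphere (0 : V) 1)) :
    ∃ x y : V, wedge e x y ≠ 0 ∧ closedBall (0 : V) 1 = hexagon x y := by
  obtain ⟨f, hf⟩ := h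
  have : Nontrivial V := ⟨e 0, 0, e.ne_zero 0⟩
  have hclosed : IsClosed (convexHull ℝ {z : ℂ | z ^ 6 = 1}) := by
    rw [convexHull_pow_six_eq_one]; exact isClosed_hexagon _ _
  have hB : closedBall (0 : V) 1 = f '' hexagon 1 sixthRoot := by
    rw [← convexHull_sphere_eq_closedBall (0 : V) zero_le_one, hf, ← convexHull_pow_six_eq_one]
    have himg : ∀ X : Set ℂ, f '' convexHull ℝ X = convexHull ℝ (f '' X) := fun X =>
      f.toAffineMap.image_convexHull X
    rw [← himg]
    congr 1
    refine Subset.antisymm ?_ ?_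
    · exact convexHull_min hclosed.frontier_subset (convex_convexHull ℝ _)
    · exact convexHull_mono pow_six_eq_one_subset_frontier
  have hlin : ∀ z : ℂ, f z = f.linear z + f 0 := by
    intro z
    have h2 := f.map_vadd 0 z
    simpa using h2
  -- Both the hexagon and the disc are symmetric, so the disc would be invariant under translation
  -- by `2 f 0`, which is impossible for a bounded nonempty set unless `f 0 = 0`.
  have h0 : f 0 = 0 := by
    have hsymm : ∀ v ∈ closedBall (0 : V) 1, v + (2 : ℝ) • f 0 ∈ closedBall (0 : V) 1 := by
      intro v hv
      have hv' : -v ∈ closedBall (0 : V) 1 := by simpa using hv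
      rw [hB] at hv' ⊢
      obtain ⟨z, hz, hzv⟩ := hv'
      refine ⟨-z, neg_mem_hexagon hz, ?_⟩
      rw [hlin] at hzv ⊢
      rw [map_neg, ← neg_neg v, ← hzv]
      module
    by_contra hne
    have hpos : 0 < ‖f 0‖ := norm_pos_iff.2 hne
    have h1 := hsymm (‖f 0‖⁻¹ • f 0) (by rw [mem_closedBall_zero_iff, norm_smul]; simp [hpos.ne'])
    rw [← add_smul, mem_closedBall_zero_iff, norm_smul, Real.norm_eq_abs,
      abs_of_pos (by positivity), add_mul, inv_mul_cancel₀ hpos.ne'] at h1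
    linarith
  have hfl : ∀ z : ℂ, f z = f.linear z := fun z => by rw [hlin, h0, add_zero]
  refine ⟨f.linear 1, f.linear sixthRoot, ?_, ?_⟩
  · intro hw
    have hne : f.linear 1 ≠ 0 := by simp
    obtain ⟨r, hr⟩ := exists_smul_of_wedge_eq_zero e hne hw
    rw [← map_smul] at hr
    have h1 := congrArg Complex.im (f.linear.injective hr)
    simp [sixthRoot] at h1
  · rw [hB]
    have := image_hexagon f.linear.toLinearMap 1 sixthRoot
    simp only [LinearEquiv.coe_coe] at this
    rw [← this]
    exact image_congr fun z _ => hfl z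

variable {e} [MeasurableSpace V] [BorelSpace V]

theorem IsExtremal.measure_closedBall_eq_three_iff (he : IsExtremal e) :
    e.addHaar (closedBall (0 : V) 1) = 3 ↔ IsAffineRegularHexagon (sphere (0 : V) 1) := by
  constructor
  · intro h3
    obtain ⟨x, y, h, hxy⟩ := he.exists_closedBall_eq_hexagon h3
    exact isAffineRegularHexagon_of_eq_hexagon e h hxy
  · intro h
    obtain ⟨x, y, hw, hxy⟩ := exists_closedBall_eq_hexagon_of_isAffineRegularHexagon e h
    exact le_antisymm (he.measure_closedBall_le hw hxy) he.three_le_measure_closedBall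

end AffineRegular

/-- A property of intervals which is additive and holds locally at every point holds globally. -/
lemma interval_induction {P : ℝ → ℝ → Prop} {a b : ℝ} (hab : a ≤ b) (hrefl : P a a)
    (htrans : ∀ s t r, a ≤ s → s ≤ t → t ≤ r → r ≤ b → P s t → P t r → P s r)
    (hloc : ∀ t ∈ Icc a b, ∃ ρ > 0, ∀ s ∈ Icc a b, |s - t| < ρ →
      (s < t → P s t) ∧ (t < s → P t s)) : P a b := by
  set Z : Set ℝ := {t | t ∈ Icc a b ∧ P a t} with hZ
  have haZ : a ∈ Z := ⟨⟨le_rfl, hab⟩, hrefl⟩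
  have hbdd : BddAbove Z := ⟨b, fun t ht => ht.1.2⟩
  set c := sSup Z with hc
  have hac : a ≤ c := le_csSup hbdd haZ
  have hcb : c ≤ b := csSup_le ⟨a, haZ⟩ fun t ht => ht.1.2
  obtain ⟨ρ, hρ, hloc'⟩ := hloc c ⟨hac, hcb⟩
  have hPc : P a c := by
    obtain ⟨s, hs, hsc⟩ := exists_lt_of_lt_csSup ⟨a, haZ⟩ (show c - ρ < sSup Z by linarith)
    rcases (le_csSup hbdd hs).eq_or_lt with h | h
    · rw [hc, ← h]; exact hs.2
    · have := (hloc' s hs.1 (by rw [abs_sub_lt_iff]; constructor <;> linarith)).1 h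
      exact htrans a s c le_rfl hs.1.1 h.le hcb hs.2 this
  rcases hcb.eq_or_lt with h | h
  · rwa [h] at hPc
  exfalso
  have h1 : c < min b (c + ρ / 2) := lt_min h (by linarith)
  have h2 : min b (c + ρ / 2) ≤ c + ρ / 2 := min_le_right _ _
  have h3 : min b (c + ρ / 2) ∈ Icc a b := ⟨by linarith, min_le_left _ _⟩
  have h4 := (hloc' _ h3 (by rw [abs_sub_lt_iff]; constructor <;> linarith)).2 h1
  have h5 : min b (c + ρ / 2) ∈ Z := ⟨h3, htrans a c _ le_rfl hac h1.le h3.2 hPc h4⟩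
  linarith [le_csSup hbdd h5]

/-! ### Sectors of a parametrized circle and the upper bound on the length -/

section Curve

variable {V : Type*} [NormedAddCommGroup V] [NormedSpace ℝ V]

/-- The union of the radii of the unit disc ending on an arc of a curve. -/
def sector (γ : ℝ → V) (s t : ℝ) : Set V :=
  {v | ∃ r τ : ℝ, 0 ≤ r ∧ r ≤ 1 ∧ s ≤ τ ∧ τ ≤ t ∧ v = r • γ τ}

lemma sector_mono (γ : ℝ → V) {s s' t t' : ℝ} (hs : s' ≤ s) (ht : t ≤ t') :
    sector γ s t ⊆ sector γ s' t' := by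
  rintro v ⟨r, τ, h1, h2, h3, h4, rfl⟩
  exact ⟨r, τ, h1, h2, hs.trans h3, h4.trans ht, rfl⟩

lemma sector_union (γ : ℝ → V) {s t r : ℝ} (hst : s ≤ t) (htr : t ≤ r) :
    sector γ s t ∪ sector γ t r = sector γ s r := by
  apply Subset.antisymm
  · exact union_subset (sector_mono γ le_rfl htr) (sector_mono γ hst le_rfl)
  · rintro v ⟨q, τ, h1, h2, h3, h4, rfl⟩
    rcases le_total τ t with h | h
    · left; exact ⟨q, τ, h1, h2, h3, h, rfl⟩
    · right; exact ⟨q, τ, h1, h2, h, h4, rfl⟩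

lemma isCompact_sector {γ : ℝ → V} {s t : ℝ} (hγ : ContinuousOn γ (Icc s t)) :
    IsCompact (sector γ s t) := by
  have : sector γ s t = (fun p : ℝ × V => p.1 • p.2) '' (Icc 0 1 ×ˢ (γ '' Icc s t)) := by
    ext v
    constructor
    · rintro ⟨r, τ, h1, h2, h3, h4, rfl⟩
      exact ⟨(r, γ τ), ⟨⟨h1, h2⟩, mem_image_of_mem γ ⟨h3, h4⟩⟩, rfl⟩
    · rintro ⟨⟨r, _⟩, ⟨⟨h1, h2⟩, ⟨τ, ⟨h3, h4⟩, rfl⟩⟩, rfl⟩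
      exact ⟨r, τ, h1, h2, h3, h4, rfl⟩
  rw [this]
  exact (isCompact_Icc.prod (isCompact_Icc.image_of_continuousOn hγ)).image (by fun_prop)

lemma eVariationOn_Icc_add_Icc (γ : ℝ → V) {s t r : ℝ} (hst : s ≤ t) (htr : t ≤ r) :
    eVariationOn γ (Icc s t) + eVariationOn γ (Icc t r) = eVariationOn γ (Icc s r) := by
  simpa using eVariationOn.Icc_add_Icc γ (s := univ) hst htr (mem_univ t)

namespace IsSimpleClosedParametrization

variable {γ : ℝ → V} {a b : ℝ}

lemma norm_eq_one (hγ : IsSimpleClosedParametrization γ a b (sphere (0 : V) 1))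
    {τ : ℝ} (h1 : a ≤ τ) (h2 : τ ≤ b) : ‖γ τ‖ = 1 := by
  have : γ τ ∈ sphere (0 : V) 1 := by
    rw [← hγ.2.2.2.2]; exact mem_image_of_mem γ ⟨h1, h2⟩
  simpa using this

lemma exists_eq (hγ : IsSimpleClosedParametrization γ a b (sphere (0 : V) 1))
    {z : V} (hz : ‖z‖ = 1) : ∃ τ, a ≤ τ ∧ τ ≤ b ∧ γ τ = z := by
  have : z ∈ γ '' Icc a b := by rw [hγ.2.2.2.2]; simpa using hz
  obtain ⟨τ, h, rfl⟩ := this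
  exact ⟨τ, h.1, h.2, rfl⟩

lemma eq_endpoints (hγ : IsSimpleClosedParametrization γ a b (sphere (0 : V) 1))
    {s t : ℝ} (hs : a ≤ s) (hst : s < t) (ht : t ≤ b) (h : γ s = γ t) :
    s = a ∧ t = b := by
  obtain ⟨hab, -, hclosed, hinj, -⟩ := hγ
  rcases ht.eq_or_lt with rfl | ht
  · rw [← hclosed] at h
    exact ⟨hinj ⟨hs, hst⟩ ⟨le_rfl, hab⟩ h, rfl⟩
  · exact absurd (hinj ⟨hs, hst.trans ht⟩ ⟨hs.trans hst.le, ht⟩ h) hst.ne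

lemma sector_eq_closedBall (hγ : IsSimpleClosedParametrization γ a b (sphere (0 : V) 1)) :
    sector γ a b = closedBall (0 : V) 1 := by
  ext v
  rw [mem_closedBall_zero_iff]
  constructor
  · rintro ⟨r, τ, h1, h2, h3, h4, rfl⟩
    rw [norm_smul, hγ.norm_eq_one h3 h4, mul_one, Real.norm_eq_abs, abs_of_nonneg h1]
    exact h2
  · intro hv
    by_cases h0 : v = 0
    · exact ⟨0, a, le_rfl, zero_le_one, le_rfl, hγ.1.le, by simp [h0]⟩
    · have hpos : ‖v‖ ≠ 0 := norm_ne_zero_iff.2 h0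
      obtain ⟨τ, h1, h2, h3⟩ := hγ.exists_eq (z := ‖v‖⁻¹ • v) (by rw [norm_smul]; simp [hpos])
      exact ⟨‖v‖, τ, norm_nonneg v, hv, h1, h2, by rw [h3, smul_smul, mul_inv_cancel₀ hpos, one_smul]⟩

lemma exists_near (hγ : IsSimpleClosedParametrization γ a b (sphere (0 : V) 1))
    {ε : ℝ} (hε : 0 < ε) :
    ∃ ρ > 0, ∀ s ∈ Icc a b, ∀ t ∈ Icc a b, |s - t| < ρ → ‖γ s - γ t‖ < ε := by
  have huc := isCompact_Icc.uniformContinuousOn_of_continuous hγ.2.1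
  obtain ⟨ρ, hρ, h⟩ := Metric.uniformContinuousOn_iff.1 huc ε hε
  refine ⟨ρ, hρ, fun s hs t ht hst => ?_⟩
  rw [← dist_eq_norm]
  exact h s hs t ht hst

variable [FiniteDimensional ℝ V]

/-- Along the arc `wedge e z (γ τ)` changes sign, so some `γ τ` is `±z`. The arc stays in an open
half-plane around `γ s` that also contains `z`, which excludes `-z`. -/
lemma exists_eq_of_mem_openCone (hγ : IsSimpleClosedParametrization γ a b (sphere (0 : V) 1))
    (e : Module.Basis (Fin 2) ℝ V) {s t : ℝ} (hs : a ≤ s) (hst : s ≤ t) (ht : t ≤ b)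
    (hnear : ∀ τ, s ≤ τ → τ ≤ t → ‖γ τ - γ s‖ < 1) {z : V} (hz : ‖z‖ = 1)
    (hzc : z ∈ openCone (γ s) (γ t)) : ∃ τ, s ≤ τ ∧ τ ≤ t ∧ γ τ = z := by
  obtain ⟨p, q, hp, hq, hzpq⟩ := hzc
  have hcont : ContinuousOn (fun τ => wedge e z (γ τ)) (uIcc s t) := by
    rw [uIcc_of_le hst]
    exact (Continuous.wedge e (continuous_const (y := z)) continuous_id).comp_continuousOn
      (hγ.2.1.mono (Icc_subset_Icc hs ht))
  have h0 : (0 : ℝ) ∈ uIcc (wedge e z (γ s)) (wedge e z (γ t)) := by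
    have h1 : wedge e z (γ t) = p * wedge e (γ s) (γ t) := by
      rw [hzpq, wedge_smul_add_smul_right]
    have h2 : wedge e z (γ s) = -(q * wedge e (γ s) (γ t)) := by
      rw [wedge_swap, hzpq, wedge_left_smul_add_smul]
    rw [h1, h2, mem_uIcc]
    rcases le_total 0 (wedge e (γ s) (γ t)) with h | h
    · left; constructor <;> nlinarith
    · right; constructor <;> nlinarith
  obtain ⟨τ, hτ, hτ0⟩ := intermediate_value_uIcc hcont h0
  rw [uIcc_of_le hst] at hτ
  refine ⟨τ, hτ.1, hτ.2, ?_⟩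
  have hxs := hγ.norm_eq_one hs (hst.trans ht)
  rcases eq_or_eq_neg_of_wedge_eq_zero e hz
    (hγ.norm_eq_one (hs.trans hτ.1) (hτ.2.trans ht)) hτ0 with h | h
  · exact h
  exfalso
  obtain ⟨χ, hχ, hχs⟩ := exists_supporting_functional (γ s)
  rw [hxs] at hχs
  have hpos : ∀ τ, s ≤ τ → τ ≤ t → 0 < χ (γ τ) := by
    intro τ h1 h2
    have h3 := abs_apply_le_of_norm_le_one hχ (γ τ - γ s)
    rw [map_sub, hχs] at h3
    linarith [hnear τ h1 h2, (abs_le.1 h3).1]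
  have h1 := hpos τ hτ.1 hτ.2
  have h2 := hpos t hst le_rfl
  rw [h, hzpq] at h1
  simp only [map_neg, map_add, map_smul, smul_eq_mul, hχs] at h1
  nlinarith [mul_pos hq h2]

lemma inter_openCone_subset_sector (hγ : IsSimpleClosedParametrization γ a b (sphere (0 : V) 1))
    (e : Module.Basis (Fin 2) ℝ V) {s t : ℝ} (hs : a ≤ s) (hst : s ≤ t) (ht : t ≤ b)
    (hnear : ∀ τ, s ≤ τ → τ ≤ t → ‖γ τ - γ s‖ < 1) :
    closedBall (0 : V) 1 ∩ openCone (γ s) (γ t) ⊆ sector γ s t := by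
  rintro v ⟨hv, p, q, hp, hq, hvpq⟩
  by_cases h0 : v = 0
  · exact ⟨0, s, le_rfl, zero_le_one, le_rfl, hst, by simp [h0]⟩
  have hpos : 0 < ‖v‖ := norm_pos_iff.2 h0
  obtain ⟨τ, h1, h2, h3⟩ := hγ.exists_eq_of_mem_openCone e hs hst ht hnear (z := ‖v‖⁻¹ • v)
    (by rw [norm_smul]; simp [hpos.ne'])
    ⟨‖v‖⁻¹ * p, ‖v‖⁻¹ * q, by positivity, by positivity, by rw [hvpq]; module⟩
  exact ⟨‖v‖, τ, norm_nonneg v, by simpa using hv, h1, h2,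
    by rw [h3, smul_smul, mul_inv_cancel₀ hpos.ne', one_smul]⟩

variable (e : Module.Basis (Fin 2) ℝ V) [MeasurableSpace V] [BorelSpace V]

lemma ne_zero_of_mem (hγ : IsSimpleClosedParametrization γ a b (sphere (0 : V) 1))
    {τ : ℝ} (h1 : a ≤ τ) (h2 : τ ≤ b) : γ τ ≠ 0 := by
  rw [← norm_ne_zero_iff, hγ.norm_eq_one h1 h2]; exact one_ne_zero

/-- By injectivity, adjacent sectors share only multiples of `γ t` and, if the curve closes up, of
`γ a`. Both sets lie on null lines. -/
lemma measure_sector_add (hγ : IsSimpleClosedParametrization γ a b (sphere (0 : V) 1))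
    {s t r : ℝ} (hs : a ≤ s) (hst : s ≤ t) (htr : t ≤ r) (hr : r ≤ b) :
    e.addHaar (sector γ s r) = e.addHaar (sector γ s t) + e.addHaar (sector γ t r) := by
  have hmeas : MeasurableSet (sector γ t r) := (isCompact_sector
    (hγ.2.1.mono (Icc_subset_Icc (hs.trans hst) hr))).isClosed.measurableSet
  rw [← sector_union γ hst htr]
  refine measure_union₀ hmeas.nullMeasurableSet ?_
  have hnull : e.addHaar ({v | wedge e (γ t) v = 0} ∪ {v | wedge e (γ a) v = 0}) = 0 :=
    measure_union_null
      (measure_wedge_level e _ (hγ.ne_zero_of_mem (hs.trans hst) (htr.trans hr)) 0)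
      (measure_wedge_level e _ (hγ.ne_zero_of_mem le_rfl hγ.1.le) 0)
  refine measure_mono_null ?_ hnull
  rintro v ⟨⟨q, τ, hq0, -, h1, h2, rfl⟩, ⟨q', τ', hq0', -, h3, h4, hv⟩⟩
  have hn := hγ.norm_eq_one (hs.trans h1) (h2.trans (htr.trans hr))
  have hn' := hγ.norm_eq_one ((hs.trans hst).trans h3) (h4.trans hr)
  have hqq : q = q' := by
    have := congrArg norm hv
    rwa [norm_smul, norm_smul, hn, hn', mul_one, mul_one, Real.norm_eq_abs, Real.norm_eq_abs,
      abs_of_nonneg hq0, abs_of_nonneg hq0'] at this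
  subst hqq
  rcases eq_or_ne q 0 with rfl | hq
  · left; simp [wedge_zero_right]
  have hγτ : γ τ = γ τ' := smul_right_injective V hq hv
  rcases (h2.trans h3).eq_or_lt with h | h
  · have : τ = t := le_antisymm h2 (by rw [h]; exact h3)
    left
    rw [this, mem_ofPred_eq, wedge_smul_right, wedge_self, mul_zero]
  · have := (hγ.eq_endpoints (hs.trans h1) h (h4.trans hr) hγτ).1
    right
    rw [this, mem_ofPred_eq, wedge_smul_right, wedge_self, mul_zero]

lemma edist_le_mul_measure_sector (hγ : IsSimpleClosedParametrization γ a b (sphere (0 : V) 1))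
    {κ : ℝ} {s t : ℝ} (hs : a ≤ s) (hst : s ≤ t) (ht : t ≤ b)
    (hnear : ∀ τ, s ≤ τ → τ ≤ t → ‖γ τ - γ s‖ < 1)
    (hκ : ∀ τ, s ≤ τ → τ ≤ t → ∀ φ ψ : V →L[ℝ] ℝ, ‖φ‖ ≤ 1 → ‖ψ‖ ≤ 1 → φ (γ τ) = 1 →
      |dualWedge e φ ψ| ≤ κ) :
    edist (γ t) (γ s) ≤ ENNReal.ofReal (2 * κ) * e.addHaar (sector γ s t) := by
  have hxs := hγ.norm_eq_one hs (hst.trans ht)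
  have hxt := hγ.norm_eq_one (hs.trans hst) ht
  by_cases hw : wedge e (γ s) (γ t) = 0
  · rcases eq_or_eq_neg_of_wedge_eq_zero e hxs hxt hw with h | h
    · simp [h]
    · have := hnear t hst le_rfl
      rw [h, show -γ s - γ s = (-2 : ℝ) • γ s by module, norm_smul, hxs] at this
      norm_num at this
  · rw [edist_dist, dist_eq_norm]
    refine (norm_sub_le_mul_measure_sector e hxs hxt hw (κ := κ) ?_).trans
      (mul_le_mul_right (measure_mono (hγ.inter_openCone_subset_sector e hs hst ht hnear)) _)
    intro z hz hzc φ ψ hφ hψ hφz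
    rcases hzc with hzc | rfl
    · obtain ⟨τ, h1, h2, rfl⟩ := hγ.exists_eq_of_mem_openCone e hs hst ht hnear hz hzc
      exact hκ τ h1 h2 φ ψ hφ hψ hφz
    · exact hκ s le_rfl hst φ ψ hφ hψ hφz

lemma sum_measure_sector (hγ : IsSimpleClosedParametrization γ a b (sphere (0 : V) 1))
    {u : ℕ → ℝ} (hu : Monotone u) (hau : ∀ i, a ≤ u i)
    (hub : ∀ i, u i ≤ b) (n : ℕ) :
    ∑ i ∈ Finset.range n, e.addHaar (sector γ (u i) (u (i + 1))) ≤
      e.addHaar (sector γ (u 0) (u n)) := by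
  induction n with
  | zero => simp
  | succ n ih =>
    rw [Finset.sum_range_succ, hγ.measure_sector_add e (hau 0) (hu n.zero_le) (hu n.le_succ) (hub _)]
    exact add_le_add_left ih _

/-- The chord estimate is summed over a partition. Keeping `κ` general allows both `κ = 1` and the
improved constant near an unframed point. -/
lemma eVariationOn_le_of_near (hγ : IsSimpleClosedParametrization γ a b (sphere (0 : V) 1))
    {κ : ℝ} {s t : ℝ} (hs : a ≤ s) (ht : t ≤ b)
    (hnear : ∀ τ τ', s ≤ τ → τ ≤ t → s ≤ τ' → τ' ≤ t → ‖γ τ - γ τ'‖ < 1)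
    (hκ : ∀ τ, s ≤ τ → τ ≤ t → ∀ φ ψ : V →L[ℝ] ℝ, ‖φ‖ ≤ 1 → ‖ψ‖ ≤ 1 → φ (γ τ) = 1 →
      |dualWedge e φ ψ| ≤ κ) :
    eVariationOn γ (Icc s t) ≤ ENNReal.ofReal (2 * κ) * e.addHaar (sector γ s t) := by
  refine iSup_le ?_
  rintro ⟨n, u, hu, hust⟩
  have hau : ∀ i, a ≤ u i := fun i => hs.trans (hust i).1
  have hub : ∀ i, u i ≤ b := fun i => (hust i).2.trans ht
  calc ∑ i ∈ Finset.range n, edist (γ (u (i + 1))) (γ (u i))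
      ≤ ∑ i ∈ Finset.range n, ENNReal.ofReal (2 * κ) * e.addHaar (sector γ (u i) (u (i + 1))) := by
        refine Finset.sum_le_sum fun i _ => ?_
        have h1 : ∀ τ, u i ≤ τ → τ ≤ u (i + 1) → s ≤ τ ∧ τ ≤ t := fun τ h1 h2 =>
          ⟨(hust i).1.trans h1, h2.trans (hust (i + 1)).2⟩
        exact hγ.edist_le_mul_measure_sector e (hau i) (hu i.le_succ) (hub _)
          (fun τ h2 h3 => hnear τ (u i) (h1 τ h2 h3).1 (h1 τ h2 h3).2 (hust i).1 (hust i).2)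
          (fun τ h2 h3 => hκ τ (h1 τ h2 h3).1 (h1 τ h2 h3).2)
    _ ≤ ENNReal.ofReal (2 * κ) * e.addHaar (sector γ (u 0) (u n)) := by
        rw [← Finset.mul_sum]
        exact mul_le_mul_right (hγ.sum_measure_sector e hu hau hub n) _
    _ ≤ _ := mul_le_mul_right (measure_mono (sector_mono γ (hust 0).1 (hust n).2)) _

/-- Both sides are additive over adjacent arcs, so `interval_induction` passes from short arcs to
all arcs. -/
lemma eVariationOn_le (hγ : IsSimpleClosedParametrization γ a b (sphere (0 : V) 1))
    {κ : ℝ} {s t : ℝ} (hs : a ≤ s) (hst : s ≤ t) (ht : t ≤ b)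
    (hκ : ∀ τ, s ≤ τ → τ ≤ t → ∀ φ ψ : V →L[ℝ] ℝ, ‖φ‖ ≤ 1 → ‖ψ‖ ≤ 1 → φ (γ τ) = 1 →
      |dualWedge e φ ψ| ≤ κ) :
    eVariationOn γ (Icc s t) ≤ ENNReal.ofReal (2 * κ) * e.addHaar (sector γ s t) := by
  obtain ⟨ρ, hρ, hnear⟩ := hγ.exists_near one_pos
  have hnear' : ∀ p q, s ≤ p → q ≤ t → q - p < ρ →
      eVariationOn γ (Icc p q) ≤ ENNReal.ofReal (2 * κ) * e.addHaar (sector γ p q) := by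
    intro p q hp hq hpq
    refine hγ.eVariationOn_le_of_near e (hs.trans hp) (hq.trans ht) ?_
      (fun τ h1 h2 => hκ τ (hp.trans h1) (h2.trans hq))
    intro τ τ' h1 h2 h3 h4
    refine hnear τ ⟨by linarith, by linarith⟩ τ' ⟨by linarith, by linarith⟩ ?_
    rw [abs_sub_lt_iff]; constructor <;> linarith
  refine interval_induction
    (P := fun p q => eVariationOn γ (Icc p q) ≤ ENNReal.ofReal (2 * κ) * e.addHaar (sector γ p q))
    hst ?_ ?_ ?_
  · rw [Icc_self, eVariationOn.subsingleton _ subsingleton_singleton]; exact zero_le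
  · intro p q r hp hpq hqr hr h1 h2
    rw [← eVariationOn_Icc_add_Icc γ hpq hqr,
      hγ.measure_sector_add e (hs.trans hp) hpq hqr (hr.trans ht), mul_add]
    exact add_le_add h1 h2
  · intro p hp
    refine ⟨ρ, hρ, fun q hq hqp => ?_⟩
    rw [abs_sub_lt_iff] at hqp
    exact ⟨fun _ => hnear' q p hq.1 hp.2 hqp.2, fun _ => hnear' p q hp.1 hq.2 hqp.1⟩

end IsSimpleClosedParametrization

end Curve

/-! ### Equality in the length bound -/

section Equality

variable {V : Type*} [NormedAddCommGroup V] [NormedSpace ℝ V] [FiniteDimensional ℝ V]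
variable {e : Module.Basis (Fin 2) ℝ V}

/-- Near a point which is not framed, the determinants of pairs of functionals containing a
supporting functional are bounded away from the maximum. -/
lemma IsExtremal.exists_gap (he : IsExtremal e) {x : V} (hx : ¬IsFramed e x) :
    ∃ η > 0, ∀ z : V, ‖z‖ = 1 → ‖z - x‖ < η → ∀ φ ψ : V →L[ℝ] ℝ, ‖φ‖ ≤ 1 → ‖ψ‖ ≤ 1 →
      φ z = 1 → |dualWedge e φ ψ| ≤ 1 - η := by
  have : ProperSpace V := FiniteDimensional.proper ℝ V
  have : ProperSpace (V →L[ℝ] ℝ) := FiniteDimensional.proper ℝ _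
  set X : Set (V × (V →L[ℝ] ℝ) × (V →L[ℝ] ℝ)) :=
    (sphere 0 1 ×ˢ (closedBall 0 1 ×ˢ closedBall 0 1)) ∩ {p | p.2.1 p.1 = 1} with hX
  have hcont : Continuous fun p : V × (V →L[ℝ] ℝ) × (V →L[ℝ] ℝ) => p.2.1 p.1 := by fun_prop
  have hXc : IsCompact X :=
    ((isCompact_sphere 0 1).prod ((isCompact_closedBall 0 1).prod (isCompact_closedBall 0 1))).inter_right
      (isClosed_eq hcont continuous_const)
  -- This vanishes only at a frame of `x`, so it has a positive lower bound `m` on the compact set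
  -- `X`. If the first summand is below `m / 2`, the second exceeds `m / 2`.
  set f : V × (V →L[ℝ] ℝ) × (V →L[ℝ] ℝ) → ℝ :=
    fun p => ‖p.1 - x‖ + (1 - |dualWedge e p.2.1 p.2.2|) with hf
  have hfc : Continuous f := by
    have := Continuous.dualWedge e
      (continuous_fst.comp continuous_snd : Continuous fun p : V × (V →L[ℝ] ℝ) × (V →L[ℝ] ℝ) => p.2.1)
      (continuous_snd.comp continuous_snd)
    exact ((continuous_fst.sub continuous_const).norm).add (continuous_const.sub this.abs)
  have hpos : ∀ p ∈ X, 0 < f p := by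
    rintro ⟨z, φ, ψ⟩ ⟨⟨-, hφ, hψ⟩, hφz⟩
    simp only [mem_closedBall_zero_iff] at hφ hψ
    have h1 : |dualWedge e φ ψ| ≤ 1 :=
      (he.abs_dualWedge_le φ ψ).trans (mul_le_one₀ hφ (norm_nonneg _) hψ)
    rcases (norm_nonneg (z - x)).eq_or_lt with h2 | h2
    · have hzx : z = x := by rw [← sub_eq_zero, ← norm_eq_zero, ← h2]
      subst hzx
      have h3 : |dualWedge e φ ψ| ≠ 1 := fun h3 => hx ⟨φ, ψ, hφ, hψ, hφz, h3⟩
      have h4 := lt_of_le_of_ne h1 h3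
      simp only [hf]; linarith
    · simp only [hf]; linarith
  obtain ⟨m, hm, hmf⟩ := hXc.exists_forall_le' hfc.continuousOn hpos
  refine ⟨m / 2, by linarith, fun z hz hzx φ ψ hφ hψ hφz => ?_⟩
  have := hmf (z, φ, ψ) ⟨⟨by simpa using hz, by simpa using hφ, by simpa using hψ⟩, hφz⟩
  simp only [hf] at this
  linarith

lemma abs_wedge_le_of_framed {y u : V} (hy : ‖y‖ ≤ 1) (hu : ‖u‖ ≤ 1) {φ ψ : V →L[ℝ] ℝ}
    (hψ : ‖ψ‖ ≤ 1) (hφy : φ y = 1) (hφu : 0 ≤ φ u) (hd : |dualWedge e φ ψ| = 1) :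
    |wedge e y u| ≤ 1 + φ u := by
  have h1 := congrArg abs (dualWedge_mul_wedge e φ ψ y u)
  rw [abs_mul, hd, one_mul, hφy, one_mul] at h1
  have h2 := abs_le.1 ((abs_apply_le_of_norm_le_one hψ y).trans hy)
  have h3 := abs_le.1 ((abs_apply_le_of_norm_le_one hψ u).trans hu)
  rw [h1, abs_le]
  constructor <;> nlinarith

/-- If all unit vectors are framed, short chords of the unit circle are asymptotically as long as
possible. -/
lemma exists_abs_wedge_le (hframed : ∀ z : V, ‖z‖ = 1 → IsFramed e z) {x : V} (hx : ‖x‖ = 1)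
    {ε : ℝ} (hε : 0 < ε) : ∃ ρ > 0, ∀ y : V, ‖y‖ = 1 → ‖y - x‖ < ρ →
      |wedge e x y| ≤ (1 + ε) * ‖y - x‖ := by
  have : ProperSpace V := FiniteDimensional.proper ℝ V
  have : ProperSpace (V →L[ℝ] ℝ) := FiniteDimensional.proper ℝ _
  by_contra! hcon
  choose y hy hyx hwy using fun n : ℕ => hcon (1 / ((n : ℝ) + 1)) Nat.one_div_pos_of_nat
  have hlim : Tendsto (fun n => ‖y n - x‖) atTop (𝓝 0) :=
    squeeze_zero (fun n => norm_nonneg _) (fun n => (hyx n).le) tendsto_one_div_add_atTop_nhds_zero_nat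
  choose φ ψ hφ hψ hφy hd using fun n => hframed (y n) (hy n)
  -- The unit chord directions. A bad chord forces `φ n (u n) > ε`; but a limit `φ'` of the `φ n`
  -- supports the circle at `x`, hence is nonpositive on every `u n` and on their limit.
  set u : ℕ → V := fun n => ‖y n - x‖⁻¹ • (y n - x) with hu
  have hpos : ∀ n, 0 < ‖y n - x‖ := by
    intro n
    rcases (norm_nonneg (y n - x)).eq_or_lt with h | h
    · have h1 : y n = x := by rw [← sub_eq_zero, ← norm_eq_zero, ← h]
      have := hwy n
      rw [h1, wedge_self] at this
      simp at this
    · exact h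
  have hunorm : ∀ n, ‖u n‖ = 1 := fun n => by
    simp only [hu]; rw [norm_smul]; simp [(hpos n).ne']
  have hyu : ∀ n, y n = x + ‖y n - x‖ • u n := fun n => by
    simp only [hu]; rw [smul_smul, mul_inv_cancel₀ (hpos n).ne', one_smul]; abel
  have hwu : ∀ n, 1 + ε < |wedge e (y n) (u n)| := by
    intro n
    have h1 : wedge e x (y n) = ‖y n - x‖ * wedge e (y n) (u n) := by
      conv_lhs => rw [hyu n]
      conv_rhs => rw [hyu n, add_sub_cancel_left]
      rw [wedge_add_right, wedge_add_left, wedge_self, wedge_smul_right, wedge_smul_left, wedge_self,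
        norm_smul, hunorm n]
      simp
    have h2 := hwy n
    rw [h1, abs_mul, abs_of_pos (hpos n), mul_comm] at h2
    exact lt_of_mul_lt_mul_left h2 (hpos n).le
  have hφu : ∀ n, 0 ≤ φ n (u n) := by
    intro n
    have h1 := (le_abs_self _).trans (abs_apply_le_of_norm_le_one (hφ n) x)
    simp only [hu, map_smul, map_sub, hφy, smul_eq_mul]
    exact mul_nonneg (inv_nonneg.2 (norm_nonneg _)) (by linarith)
  have hgt : ∀ n, ε < φ n (u n) := by
    intro n
    have := abs_wedge_le_of_framed (hy n).le (hunorm n).le (hψ n) (hφy n) (hφu n) (hd n)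
    linarith [hwu n]
  have hcomp : IsCompact (closedBall (0 : V) 1 ×ˢ closedBall (0 : V →L[ℝ] ℝ) 1) :=
    (isCompact_closedBall 0 1).prod (isCompact_closedBall 0 1)
  obtain ⟨⟨u', φ'⟩, ⟨-, hφ'⟩, k, hk, hkl⟩ := hcomp.tendsto_subseq
    (x := fun n => (u n, φ n)) (fun n => ⟨by simpa using (hunorm n).le, by simpa using hφ n⟩)
  have hul : Tendsto (fun n => u (k n)) atTop (𝓝 u') := (continuous_fst.tendsto _).comp hkl
  have hφl : Tendsto (fun n => φ (k n)) atTop (𝓝 φ') := (continuous_snd.tendsto _).comp hkl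
  have hφ'1 : ‖φ'‖ ≤ 1 := by simpa using hφ'
  have hyl : Tendsto (fun n => y (k n)) atTop (𝓝 x) := by
    rw [tendsto_iff_norm_sub_tendsto_zero]
    exact hlim.comp hk.tendsto_atTop
  have happ : Continuous fun p : (V →L[ℝ] ℝ) × V => p.1 p.2 := by fun_prop
  have hφx : φ' x = 1 := by
    have h1 : Tendsto (fun n => φ (k n) (y (k n))) atTop (𝓝 (φ' x)) :=
      (happ.tendsto (φ', x)).comp (hφl.prodMk_nhds hyl)
    simp only [hφy] at h1
    exact tendsto_nhds_unique h1 tendsto_const_nhds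
  have h1 : Tendsto (fun n => φ (k n) (u (k n))) atTop (𝓝 (φ' u')) :=
    (happ.tendsto (φ', u')).comp (hφl.prodMk_nhds hul)
  have h2 : ε ≤ φ' u' := ge_of_tendsto' h1 fun n => (hgt _).le
  have h3 : Tendsto (fun n => φ' (u (k n))) atTop (𝓝 (φ' u')) :=
    (φ'.continuous.tendsto _).comp hul
  have h4 : φ' u' ≤ 0 := by
    refine le_of_tendsto' h3 fun n => ?_
    have h5 := (le_abs_self _).trans (abs_apply_le_of_norm_le_one hφ'1 (y (k n)))
    rw [hy] at h5
    simp only [hu, map_smul, map_sub, hφx, smul_eq_mul]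
    exact mul_nonpos_of_nonneg_of_nonpos (inv_nonneg.2 (norm_nonneg _)) (by linarith)
  linarith

namespace IsSimpleClosedParametrization

variable {γ : ℝ → V} {a b : ℝ}

/-- A short subarc stays in the cone spanned by its endpoints. -/
lemma exists_nonneg_coeff (hγ : IsSimpleClosedParametrization γ a b (sphere (0 : V) 1))
    (e : Module.Basis (Fin 2) ℝ V) {s t : ℝ} (hs : a ≤ s) (hst : s < t)
    (ht : t ≤ b) (hne : ¬(s = a ∧ t = b))
    (hnear : ∀ τ τ', s ≤ τ → τ ≤ t → s ≤ τ' → τ' ≤ t → ‖γ τ - γ τ'‖ < 1) {τ : ℝ} (h1 : s ≤ τ)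
    (h2 : τ ≤ t) : ∃ p q : ℝ, 0 ≤ p ∧ 0 ≤ q ∧ γ τ = p • γ s + q • γ t := by
  have hxs := hγ.norm_eq_one hs (hst.le.trans ht)
  have hxt := hγ.norm_eq_one (hs.trans hst.le) ht
  have hw : wedge e (γ s) (γ t) ≠ 0 := by
    intro h
    rcases eq_or_eq_neg_of_wedge_eq_zero e hxs hxt h with h3 | h3
    · exact hne (hγ.eq_endpoints hs hst ht h3.symm)
    · have := hnear t s hst.le le_rfl le_rfl hst.le
      rw [h3, show -γ s - γ s = (-2 : ℝ) • γ s by module, norm_smul, hxs] at this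
      norm_num at this
  have heq := eq_smul_add_of_wedge_ne_zero e hw (γ τ)
  set p := wedge e (γ τ) (γ t) / wedge e (γ s) (γ t)
  set q := wedge e (γ s) (γ τ) / wedge e (γ s) (γ t)
  obtain ⟨χ, hχ, hχs⟩ := exists_supporting_functional (γ s)
  rw [hxs] at hχs
  have hpos : ∀ τ, s ≤ τ → τ ≤ t → 0 < χ (γ τ) := by
    intro τ h1 h2
    have h3 := abs_apply_le_of_norm_le_one hχ (γ τ - γ s)
    rw [map_sub, hχs] at h3
    linarith [hnear τ s h1 h2 le_rfl hst.le, (abs_le.1 h3).1]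
  have hχt := hpos t hst.le le_rfl
  have hχτ := hpos τ h1 h2
  have hval : χ (γ τ) = p + q * χ (γ t) := by
    conv_lhs => rw [heq]
    simp [hχs]
  refine ⟨p, q, ?_, ?_, heq⟩
  · by_contra! hp
    have hq : 0 < q := by
      by_contra! hq
      nlinarith
    -- A negative coefficient at `γ s` puts `γ t` in the open cone of `γ s` and `γ τ`, so the arc
    -- would pass through `γ t` before time `t`. A negative coefficient at `γ t` is excluded in the
    -- same way at the other end.
    obtain ⟨τ', h3, h4, h5⟩ := hγ.exists_eq_of_mem_openCone e hs h1 (h2.trans ht)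
      (fun τ' h3 h4 => hnear τ' s h3 (h4.trans h2) le_rfl hst.le) hxt
      ⟨-p / q, q⁻¹, div_pos (by linarith) hq, inv_pos.2 hq, by
        conv_rhs => rw [heq]
        rw [smul_add, smul_smul, smul_smul, inv_mul_cancel₀ hq.ne', one_smul, ← add_assoc, ← add_smul,
          show -p / q + q⁻¹ * p = 0 by ring, zero_smul, zero_add]⟩
    have hτt : τ < t := by
      refine lt_of_le_of_ne h2 fun h => ?_
      have : p = 0 := by simp only [p, h, wedge_self, zero_div]
      linarith
    have h6 := hγ.eq_endpoints (hs.trans h3) (h4.trans_lt hτt) ht h5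
    exact hne ⟨le_antisymm (by linarith [h6.1]) hs, h6.2⟩
  · by_contra! hq
    have hp : 0 < p := by
      by_contra! hp
      nlinarith
    obtain ⟨τ', h3, h4, h5⟩ := hγ.exists_eq_of_mem_openCone e (hs.trans h1) h2 ht
      (fun τ' h3 h4 => hnear τ' τ (h1.trans h3) h4 h1 h2) hxs
      ⟨p⁻¹, -q / p, inv_pos.2 hp, div_pos (by linarith) hp, by
        conv_rhs => rw [heq]
        rw [smul_add, smul_smul, smul_smul, inv_mul_cancel₀ hp.ne', one_smul, add_assoc, ← add_smul,
          show p⁻¹ * q + -q / p = 0 by ring, zero_smul, add_zero]⟩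
    have hτs : s < τ := by
      refine lt_of_le_of_ne h1 fun h => ?_
      have : q = 0 := by simp only [q, ← h, wedge_self, zero_div]
      linarith
    have h6 := hγ.eq_endpoints hs (hτs.trans_le h3) (h4.trans ht) h5.symm
    exact hne ⟨h6.1, le_antisymm ht (by linarith [h6.2])⟩

variable [MeasurableSpace V] [BorelSpace V]

/-- A unit vector `p γ s + q γ t` with `p, q ≥ 0` has `p + q ≤ (1 - ε)⁻¹`, because the endpoints
differ by at most `ε`. So the sector fits in the triangle over the chord, enlarged by this factor.
-/
lemma measure_sector_le (hγ : IsSimpleClosedParametrization γ a b (sphere (0 : V) 1))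
    (e : Module.Basis (Fin 2) ℝ V) {s t : ℝ} (hs : a ≤ s) (hst : s < t)
    (ht : t ≤ b) (hne : ¬(s = a ∧ t = b))
    (hnear : ∀ τ τ', s ≤ τ → τ ≤ t → s ≤ τ' → τ' ≤ t → ‖γ τ - γ τ'‖ < 1) {ε : ℝ} (hε : ε < 1)
    (hε' : ‖γ t - γ s‖ ≤ ε) :
    e.addHaar (sector γ s t) ≤
      ENNReal.ofReal ((1 - ε)⁻¹ ^ 2 * |wedge e (γ s) (γ t)| / 2) := by
  have hxs := hγ.norm_eq_one hs (hst.le.trans ht)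
  have hxt := hγ.norm_eq_one (hs.trans hst.le) ht
  have hε1 : 0 < 1 - ε := by linarith
  have hw : wedge e (γ s) (γ t) ≠ 0 := by
    intro h
    rcases eq_or_eq_neg_of_wedge_eq_zero e hxs hxt h with h3 | h3
    · exact hne (hγ.eq_endpoints hs hst ht h3.symm)
    · have := hnear t s hst.le le_rfl le_rfl hst.le
      rw [h3, show -γ s - γ s = (-2 : ℝ) • γ s by module, norm_smul, hxs] at this
      norm_num at this
  have hsub : sector γ s t ⊆ triangle ((1 - ε)⁻¹ • γ s) ((1 - ε)⁻¹ • γ t) := by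
    rintro v ⟨r, τ, hr0, hr1, h1, h2, rfl⟩
    obtain ⟨p, q, hp, hq, heq⟩ := hγ.exists_nonneg_coeff e hs hst ht hne hnear h1 h2
    have hn := hγ.norm_eq_one (hs.trans h1) (h2.trans ht)
    have hpq : (p + q) * (1 - ε) ≤ 1 := by
      have h3 : ‖(p + q) • γ s‖ ≤ ‖γ τ‖ + ‖q • (γ t - γ s)‖ := by
        have h4 : (p + q) • γ s = γ τ - q • (γ t - γ s) := by rw [heq]; module
        rw [h4]; exact norm_sub_le _ _
      rw [norm_smul, norm_smul, hn, hxs, Real.norm_eq_abs, Real.norm_eq_abs,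
        abs_of_nonneg (add_nonneg hp hq), abs_of_nonneg hq] at h3
      have h5 : 0 ≤ ε := (norm_nonneg _).trans hε'
      nlinarith
    refine ⟨r * p * (1 - ε), r * q * (1 - ε), by positivity, by positivity, ?_, ?_⟩
    · calc r * p * (1 - ε) + r * q * (1 - ε) = r * ((p + q) * (1 - ε)) := by ring
        _ ≤ 1 := mul_le_one₀ hr1 (by positivity) hpq
    · rw [heq, smul_smul, smul_smul, mul_assoc, mul_inv_cancel₀ hε1.ne', mul_one, mul_assoc (r * q),
        mul_inv_cancel₀ hε1.ne', mul_one, smul_add, smul_smul, smul_smul]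
  refine (measure_mono hsub).trans ?_
  have h6 : wedge e ((1 - ε)⁻¹ • γ s) ((1 - ε)⁻¹ • γ t) =
      (1 - ε)⁻¹ ^ 2 * wedge e (γ s) (γ t) := by
    rw [wedge_smul_left, wedge_smul_right]; ring
  rw [(measure_triangles e (by rw [h6]; positivity)).2, h6, abs_mul, abs_of_pos (by positivity)]

lemma eVariationOn_le_two_mul (hγ : IsSimpleClosedParametrization γ a b (sphere (0 : V) 1))
    (he : IsExtremal e) :
    eVariationOn γ (Icc a b) ≤ 2 * e.addHaar (closedBall (0 : V) 1) := by
  have := hγ.eVariationOn_le e (κ := 1) le_rfl hγ.1.le le_rfl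
    (fun τ _ _ φ ψ hφ hψ _ => (he.abs_dualWedge_le φ ψ).trans (mul_le_one₀ hφ (norm_nonneg _) hψ))
  rw [hγ.sector_eq_closedBall] at this
  simpa using this

lemma measure_sector_ne_top (hγ : IsSimpleClosedParametrization γ a b (sphere (0 : V) 1))
    (e : Module.Basis (Fin 2) ℝ V) {s t : ℝ} (hs : a ≤ s) (ht : t ≤ b) :
    e.addHaar (sector γ s t) ≠ ⊤ :=
  (isCompact_sector (hγ.2.1.mono (Icc_subset_Icc hs ht))).measure_lt_top.ne

lemma eVariationOn_lt_two_mul (hγ : IsSimpleClosedParametrization γ a b (sphere (0 : V) 1))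
    (he : IsExtremal e) {x : V} (hx : ‖x‖ = 1) (hxf : ¬IsFramed e x) :
    eVariationOn γ (Icc a b) < 2 * e.addHaar (closedBall (0 : V) 1) := by
  obtain ⟨η, hη, hgap⟩ := he.exists_gap hxf
  obtain ⟨t₀, ht₀, ht₀', rfl⟩ := hγ.exists_eq hx
  obtain ⟨ρ, hρ, hnear⟩ := hγ.exists_near hη
  have hab := hγ.1
  obtain ⟨c, d, hac, hcd, hdb, hclose⟩ : ∃ c d, a ≤ c ∧ c < d ∧ d ≤ b ∧
      ∀ τ, c ≤ τ → τ ≤ d → |τ - t₀| < ρ := by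
    refine ⟨max a (t₀ - ρ / 2), min b (t₀ + ρ / 2), le_max_left _ _, ?_, min_le_left _ _, ?_⟩
    · rw [max_lt_iff, lt_min_iff, lt_min_iff]
      rcases ht₀.eq_or_lt with h | h <;> refine ⟨⟨?_, ?_⟩, ?_, ?_⟩ <;> linarith
    · intro τ h1 h2
      have h3 := (le_max_right a (t₀ - ρ / 2)).trans h1
      have h4 := h2.trans (min_le_right b (t₀ + ρ / 2))
      rw [abs_sub_lt_iff]; constructor <;> linarith
  have hone : ∀ φ ψ : V →L[ℝ] ℝ, ‖φ‖ ≤ 1 → ‖ψ‖ ≤ 1 → |dualWedge e φ ψ| ≤ 1 := fun φ ψ hφ hψ =>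
    (he.abs_dualWedge_le φ ψ).trans (mul_le_one₀ hφ (norm_nonneg _) hψ)
  have i1 := hγ.eVariationOn_le e (κ := 1) le_rfl hac (hcd.le.trans hdb)
    (fun τ _ _ φ ψ hφ hψ _ => hone φ ψ hφ hψ)
  have i3 := hγ.eVariationOn_le e (κ := 1) (hac.trans hcd.le) hdb le_rfl
    (fun τ _ _ φ ψ hφ hψ _ => hone φ ψ hφ hψ)
  have i2 := hγ.eVariationOn_le e (κ := 1 - η) hac hcd.le hdb
    (fun τ h1 h2 => hgap (γ τ) (hγ.norm_eq_one (hac.trans h1) (h2.trans hdb))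
      (hnear τ ⟨hac.trans h1, h2.trans hdb⟩ t₀ ⟨ht₀, ht₀'⟩ (hclose τ h1 h2)))
  rw [← hγ.sector_eq_closedBall, hγ.measure_sector_add e le_rfl hac (hcd.le.trans hdb) le_rfl,
    hγ.measure_sector_add e hac hcd.le hdb le_rfl,
    ← eVariationOn_Icc_add_Icc γ hac (hcd.le.trans hdb), ← eVariationOn_Icc_add_Icc γ hcd.le hdb,
    mul_add, mul_add]
  -- A null sector would make `γ` constant on the arc. The midpoint is compared with `c`, since `c`
  -- and `d` themselves may be the identified endpoints `a` and `b`.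
  have hpos : 0 < e.addHaar (sector γ c d) := by
    rw [pos_iff_ne_zero]
    intro h0
    rw [h0, mul_zero] at i2
    have h1 := eVariationOn.edist_le γ (s := Icc c d) (x := c) (y := (c + d) / 2)
      ⟨le_rfl, hcd.le⟩ ⟨by linarith, by linarith⟩
    have h2 : γ c = γ ((c + d) / 2) := edist_le_zero.1 (h1.trans i2)
    have := (hγ.eq_endpoints hac (by linarith) (by linarith) h2).2
    linarith
  have f1 := hγ.measure_sector_ne_top e le_rfl (hcd.le.trans hdb)
  have f2 := hγ.measure_sector_ne_top e hac hdb
  have f3 := hγ.measure_sector_ne_top e (hac.trans hcd.le) le_rfl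
  have i2' : eVariationOn γ (Icc c d) < 2 * e.addHaar (sector γ c d) := by
    refine i2.trans_lt ((ENNReal.mul_lt_mul_iff_left hpos.ne' f2).2 ?_)
    rw [show (2 : ENNReal) = ENNReal.ofReal 2 by norm_num, ENNReal.ofReal_lt_ofReal_iff two_pos]
    linarith
  rw [mul_one, ENNReal.ofReal_ofNat] at i1 i3
  have v1 : eVariationOn γ (Icc a c) ≠ ⊤ :=
    ne_top_of_le_ne_top (ENNReal.mul_ne_top ENNReal.ofNat_ne_top f1) i1
  have v3 : eVariationOn γ (Icc d b) ≠ ⊤ :=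
    ne_top_of_le_ne_top (ENNReal.mul_ne_top ENNReal.ofNat_ne_top f3) i3
  exact ENNReal.add_lt_add_of_le_of_lt v1 i1 (ENNReal.add_lt_add_of_lt_of_le v3 i2' i3)

lemma two_mul_measure_le (hγ : IsSimpleClosedParametrization γ a b (sphere (0 : V) 1))
    (hframed : ∀ z : V, ‖z‖ = 1 → IsFramed e z) {ε : ℝ} (hε : 0 < ε)
    (hε1 : ε < 1) : 2 * e.addHaar (closedBall (0 : V) 1) ≤
      ENNReal.ofReal ((1 - ε)⁻¹ ^ 2 * (1 + ε)) * eVariationOn γ (Icc a b) := by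
  obtain ⟨ρ₁, hρ₁, hnear₁⟩ := hγ.exists_near one_pos
  obtain ⟨ρ₂, hρ₂, hnear₂⟩ := hγ.exists_near hε
  have hab := hγ.1
  have hε2 : 0 < 1 - ε := by linarith
  rw [← hγ.sector_eq_closedBall]
  have hlocal : ∀ s t, a ≤ s → s < t → t ≤ b → t - s < ρ₁ → t - s < ρ₂ → t - s < b - a →
      |wedge e (γ s) (γ t)| ≤ (1 + ε) * ‖γ t - γ s‖ →
      2 * e.addHaar (sector γ s t) ≤
        ENNReal.ofReal ((1 - ε)⁻¹ ^ 2 * (1 + ε)) * eVariationOn γ (Icc s t) := by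
    intro s t hs hst ht h1 h2 h3 hw
    have h4 := hγ.measure_sector_le e hs hst ht (by rintro ⟨rfl, rfl⟩; exact lt_irrefl _ h3)
      (fun τ τ' a1 a2 a3 a4 => hnear₁ τ ⟨by linarith, by linarith⟩ τ' ⟨by linarith, by linarith⟩
        (by rw [abs_sub_lt_iff]; constructor <;> linarith)) hε1
      (hnear₂ t ⟨by linarith, by linarith⟩ s ⟨by linarith, by linarith⟩
        (by rw [abs_sub_lt_iff]; constructor <;> linarith)).le
    have h5 : edist (γ t) (γ s) ≤ eVariationOn γ (Icc s t) :=
      eVariationOn.edist_le γ ⟨hst.le, le_rfl⟩ ⟨le_rfl, hst.le⟩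
    refine le_trans ?_ (mul_le_mul_right h5 _)
    refine (mul_le_mul_right h4 2).trans ?_
    rw [edist_dist, dist_eq_norm, show (2 : ENNReal) = ENNReal.ofReal 2 by norm_num,
      ← ENNReal.ofReal_mul two_pos.le, ← ENNReal.ofReal_mul (by positivity)]
    apply ENNReal.ofReal_le_ofReal
    have h6 : 0 ≤ (1 - ε)⁻¹ ^ 2 := by positivity
    nlinarith
  refine interval_induction (P := fun s t => 2 * e.addHaar (sector γ s t) ≤
    ENNReal.ofReal ((1 - ε)⁻¹ ^ 2 * (1 + ε)) * eVariationOn γ (Icc s t)) hab.le ?_ ?_ ?_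
  · have : e.addHaar (sector γ a a) = 0 := by
      refine measure_mono_null ?_ (measure_wedge_level e e.addHaar
        (hγ.ne_zero_of_mem le_rfl hab.le) 0)
      rintro v ⟨r, τ, -, -, h1, h2, rfl⟩
      rw [le_antisymm h2 h1, mem_ofPred_eq, wedge_smul_right, wedge_self, mul_zero]
    rw [this, mul_zero]; exact zero_le
  · intro s t r hs hst htr hr h1 h2
    rw [hγ.measure_sector_add e hs hst htr hr, ← eVariationOn_Icc_add_Icc γ hst htr, mul_add, mul_add]
    exact add_le_add h1 h2
  · intro t ht
    have hxt := hγ.norm_eq_one ht.1 ht.2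
    obtain ⟨ρ₃, hρ₃, hchord⟩ := exists_abs_wedge_le hframed hxt hε
    obtain ⟨ρ₄, hρ₄, hnear₄⟩ := hγ.exists_near hρ₃
    -- The bound `b - a` keeps the subarc from being the whole closed curve, whose endpoints
    -- coincide.
    refine ⟨min (min ρ₁ ρ₂) (min ρ₄ (b - a)),
      lt_min (lt_min hρ₁ hρ₂) (lt_min hρ₄ (by linarith)), fun s hs hst => ?_⟩
    rw [lt_min_iff, lt_min_iff, lt_min_iff] at hst
    obtain ⟨⟨g1, g2⟩, g4, g5⟩ := hst
    have hxs := hγ.norm_eq_one hs.1 hs.2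
    have hw := hchord (γ s) hxs (hnear₄ s hs t ht g4)
    rw [abs_sub_lt_iff] at g1 g2 g5
    constructor
    · intro h
      refine hlocal s t hs.1 h ht.2 g1.2 g2.2 g5.2 ?_
      rwa [wedge_swap, abs_neg, norm_sub_rev]
    · intro h
      exact hlocal t s ht.1 h hs.2 g1.1 g2.1 g5.1 hw

lemma two_mul_measure_eq (hγ : IsSimpleClosedParametrization γ a b (sphere (0 : V) 1))
    (he : IsExtremal e) (hframed : ∀ z : V, ‖z‖ = 1 → IsFramed e z) :
    2 * e.addHaar (closedBall (0 : V) 1) = eVariationOn γ (Icc a b) := by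
  refine le_antisymm ?_ (hγ.eVariationOn_le_two_mul he)
  have : ProperSpace V := FiniteDimensional.proper ℝ V
  have hfin : eVariationOn γ (Icc a b) ≠ ⊤ :=
    ne_top_of_le_ne_top (ENNReal.mul_ne_top ENNReal.ofNat_ne_top
      measure_closedBall_lt_top.ne) (hγ.eVariationOn_le_two_mul he)
  have hlim : Tendsto (fun ε : ℝ => ENNReal.ofReal ((1 - ε)⁻¹ ^ 2 * (1 + ε)) *
      eVariationOn γ (Icc a b)) (𝓝[>] 0) (𝓝 (1 * eVariationOn γ (Icc a b))) := by
    refine ENNReal.Tendsto.mul_const ?_ (Or.inr hfin)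
    rw [← ENNReal.ofReal_one]
    refine ENNReal.tendsto_ofReal (tendsto_nhdsWithin_of_tendsto_nhds ?_)
    have hc : ContinuousAt (fun ε : ℝ => (1 - ε)⁻¹ ^ 2 * (1 + ε)) 0 := by
      have : ContinuousAt (fun ε : ℝ => (1 - ε)⁻¹) 0 :=
        ContinuousAt.inv₀ (by fun_prop) (by norm_num)
      fun_prop
    simpa using hc.tendsto
  rw [one_mul] at hlim
  refine ge_of_tendsto hlim ?_
  filter_upwards [Ioo_mem_nhdsGT (zero_lt_one' ℝ)] with ε hε
  exact hγ.two_mul_measure_le hframed hε.1 hε.2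

end IsSimpleClosedParametrization

end Equality

end MinkowskiPlane

/-! ### Assembly in the normalised measure -/

open MinkowskiPlane in
theorem mainTheorem2 {V : Type*} [NormedAddCommGroup V] [NormedSpace ℝ V]
    (hdim : Module.finrank ℝ V = 2) [MeasurableSpace V] [BorelSpace V]
    (μ : MeasureTheory.Measure V) [μ.IsAddHaarMeasure] (P : Set V)
    (hP : MinkowskiPlane.IsMinCircumscribedParallelogram μ (Metric.sphere (0 : V) 1) P) :
    (∀ (γ : ℝ → V) (a b : ℝ),
      MinkowskiPlane.IsSimpleClosedParametrization γ a b (Metric.sphere (0 : V) 1) →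
        MinkowskiPlane.curveLength γ a b / 8 ≤ μ (Metric.closedBall (0 : V) 1) / μ P ∧
        (μ (Metric.closedBall (0 : V) 1) / μ P = MinkowskiPlane.curveLength γ a b / 8 ↔
          MinkowskiPlane.IsEquiframed μ (Metric.closedBall (0 : V) 1))) ∧
    3 / 4 ≤ μ (Metric.closedBall (0 : V) 1) / μ P ∧
    (μ (Metric.closedBall (0 : V) 1) / μ P = 3 / 4 ↔
      MinkowskiPlane.IsAffineRegularHexagon (Metric.sphere (0 : V) 1)) := by
  have : FiniteDimensional ℝ V := Module.finite_of_finrank_eq_succ hdim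
  obtain ⟨e, he, hP4⟩ := IsMinCircumscribedParallelogram.exists_isExtremal
    (Module.finBasisOfFinrankEq ℝ V hdim) subset_rfl Metric.sphere_subset_closedBall (by simp) hP
  have hequi := isEquiframed_iff he μ hP.1 hP4
  have hratio : μ (Metric.closedBall (0 : V) 1) / μ P =
      e.addHaar (Metric.closedBall (0 : V) 1) / 4 := by
    obtain ⟨c, hc0, hct, rfl⟩ := exists_eq_smul_addHaar e μ
    rw [MeasureTheory.Measure.smul_apply, MeasureTheory.Measure.smul_apply, hP4, smul_eq_mul,
      smul_eq_mul, ENNReal.mul_div_mul_left _ _ hc0 hct]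
  -- With `P` of area 4, the factor 1/8 in the length bound is the comparison of the length with
  -- twice the area of the disc.
  have h8 : e.addHaar (Metric.closedBall (0 : V) 1) / 4 =
      2 * e.addHaar (Metric.closedBall (0 : V) 1) / 8 := by
    rw [show (8 : ENNReal) = 2 * 4 by norm_num,
      ENNReal.mul_div_mul_left _ _ two_ne_zero ENNReal.ofNat_ne_top]
  have hcancel : ∀ {x y c : ENNReal}, c ≠ 0 → c ≠ ⊤ → (x / c = y / c ↔ x = y) := by
    intro x y c hc0 hct
    rw [ENNReal.div_eq_div_iff hc0 hct hc0 hct, ENNReal.mul_right_inj hc0 hct]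
  rw [hratio]
  refine ⟨fun γ a b hγ => ⟨?_, ?_⟩, ENNReal.div_le_div_right he.three_le_measure_closedBall 4, ?_⟩
  · rw [h8]
    exact ENNReal.div_le_div_right (hγ.eVariationOn_le_two_mul he) 8
  · rw [h8, hcancel (by norm_num) ENNReal.ofNat_ne_top, hequi]
    constructor
    · intro heq z hz
      by_contra hzf
      exact (hγ.eVariationOn_lt_two_mul he hz hzf).ne' heq
    · intro hframed
      exact hγ.two_mul_measure_eq he hframed
  · rw [hcancel (by norm_num) ENNReal.ofNat_ne_top]
    exact he.measure_closedBall_eq_three_iff
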